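/- Let $\mathfrak g$ be a four-dimensional real Lie algebra. On $\Phi(\mathfrak g)=\mathfrak g\oplus\mathfrak g^*$ consider the metric $\langle u+\alpha,v+\beta\rangle=\tfrac12(\alpha(v)+\beta(u))$ and the bracket $$[u+\alpha,v+\beta]^{\triangleright}=[u,v]+\mathrm{ad}^t_u\beta-\mathrm{ad}^t_v\alpha,\qquad (\mathrm{ad}^t_u\beta)(w)=-\beta([u,w]).$$ A *generalized complex structure* on $\mathfrak g$ is a real linear endomorphism $K$ of $\Phi(\mathfrak g)$ such that $K^2=-\mathrm{Id}$, $\langle Ka,b\rangle+\langle Kb,a\rangle=0$ and $$[Ka,Kb]^{\triangleright}-K[Ka,b]^{\triangleright}-K[a,Kb]^{\triangleright}+K^2[a,b]^{\triangleright}=0\qquad\text{for all }a,b\in\Phi(\mathfrak g).$$ Then $\mathfrak g$ carries no generalized complex structure if and only if it is isomorphic to one of the following Lie algebras: 1. $A_{3,2}\oplus A_1$; 2. $A_{3,5}^{\alpha}\oplus A_1$ for some $\alpha\in\mathbb R$ with $0<|\alpha|<1$; 3. $A_{4,4}$; 4. $A_{4,2}^{\alpha}$ for some $\alpha\in\mathbb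 R$ with $|\alpha|\neq1$; 5. $A_{4,5}^{\alpha,\beta}$ for some $\alpha,\beta\in\mathbb R$ with $-1<\alpha<\beta<1$ and $\alpha+\beta\neq0$. Here $A_1$ is the one-dimensional Lie algebra and the others are given, in a basis $(f_i)$, by the following brackets (those of basis vectors that are not determined by these and skew-symmetry are zero): - $A_{3,2}$: $[f_1,f_3]=f_1$, $[f_2,f_3]=f_1+f_2$; - $A_{3,5}^{\alpha}$: $[f_1,f_3]=f_1$, $[f_2,f_3]=\alpha f_2$; - $A_{4,2}^{\alpha}$: $[f_1,f_4]=\alpha f_1$, $[f_2,f_4]=f_2$, $[f_3,f_4]=f_2+f_3$; - $A_{4,4}$: $[f_1,f_4]=f_1$, $[f_2,f_4]=f_1+f_2$, $[f_3,f_4]=f_2+f_3$; - $A_{4,5}^{\alpha,\beta}$: $[f_1,f_4]=f_1$, $[f_2,f_4]=\alpha f_2$, $[f_3,f_4]=\beta f_3$. -/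

import Mathlib

open scoped Matrix

/-! ### Generalized complex structures on a real Lie algebra `g` -/

/-- The transposed adjoint action of `u` on `g*`: `⟨ad_u^t β, v⟩ = -⟨β, [u, v]⟩`. -/
def coadjoint {g : Type*} [LieRing g] [LieAlgebra ℝ g] (u : g) (β : Module.Dual ℝ g) :
    Module.Dual ℝ g :=
  -(β ∘ₗ (LieAlgebra.ad ℝ g u : g →ₗ[ℝ] g))

/-- The restriction of the Courant bracket to the left invariant sections `Φ(g) = g ⊕ g*`:
`[u + α, v + β] = [u, v] + ad_u^t β - ad_v^t α`. -/
def courantBracket {g : Type*} [LieRing g] [LieAlgebra ℝ g] (a b : g × Module.Dual ℝ g) :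
    g × Module.Dual ℝ g :=
  (⁅a.1, b.1⁆, coadjoint a.1 b.2 - coadjoint b.1 a.2)

/-- The neutral metric on `Φ(g) = g ⊕ g*`: `⟨u + α, v + β⟩ = (α(v) + β(u)) / 2`. -/
noncomputable def neutralMetric {g : Type*} [LieRing g] [LieAlgebra ℝ g]
    (a b : g × Module.Dual ℝ g) : ℝ :=
  (1 / 2) * (a.2 b.1 + b.2 a.1)

/-- The Nijenhuis torsion of an endomorphism `K` of `Φ(g)` for the Courant bracket. -/
def courantNijenhuis {g : Type*} [LieRing g] [LieAlgebra ℝ g]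
    (K : Module.End ℝ (g × Module.Dual ℝ g)) (a b : g × Module.Dual ℝ g) :
    g × Module.Dual ℝ g :=
  courantBracket (K a) (K b) - K (courantBracket (K a) b) - K (courantBracket a (K b))
    + K (K (courantBracket a b))

/-- `K` is a generalized complex structure on the Lie algebra `g` (of any type): a complex
structure on `Φ(g) = g ⊕ g*` which is skew-symmetric for the neutral metric. -/
structure IsGeneralizedComplexStructure {g : Type*} [LieRing g] [LieAlgebra ℝ g]
    (K : Module.End ℝ (g × Module.Dual ℝ g)) : Prop where
  sq_eq_neg_one : ∀ a, K (K a) = -a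
  skew : ∀ a b, neutralMetric (K a) b + neutralMetric (K b) a = 0
  torsion_eq_zero : ∀ a b, courantNijenhuis K a b = 0

/-! ### The Lie algebras of the list

Each of them (up to an abelian summand) has a basis `f₁, …, fₙ, fₙ₊₁` in which the only
nonzero brackets are the `[fⱼ, fₙ₊₁] = ∑ᵢ Dᵢⱼ fᵢ`, `j ≤ n`, for a matrix `D`. -/

/-- The vector space `ℝⁿ × ℝ`, which carries below the bracket
`[(x, s), (y, t)] = (t D x - s D y, 0)`. -/
@[ext] structure AlmostAbelian {n : ℕ} (D : Matrix (Fin n) (Fin n) ℝ) : Type where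
  /-- The coordinates on `f₁, …, fₙ`. -/
  left : Fin n → ℝ
  /-- The coordinate on `fₙ₊₁`. -/
  right : ℝ

namespace AlmostAbelian

variable {n : ℕ} (D : Matrix (Fin n) (Fin n) ℝ)

/-- The underlying set is `ℝⁿ × ℝ`. -/
def toProd : AlmostAbelian D ≃ (Fin n → ℝ) × ℝ where
  toFun a := (a.left, a.right)
  invFun p := ⟨p.1, p.2⟩
  left_inv _ := rfl
  right_inv _ := rfl

noncomputable instance : AddCommGroup (AlmostAbelian D) := (toProd D).addCommGroup

noncomputable instance : Module ℝ (AlmostAbelian D) := (toProd D).module ℝ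

noncomputable instance : Bracket (AlmostAbelian D) (AlmostAbelian D) where
  bracket a b := ⟨b.right • (D *ᵥ a.left) - a.right • (D *ᵥ b.left), 0⟩

theorem left_add (a b : AlmostAbelian D) : (a + b).left = a.left + b.left := rfl

theorem right_add (a b : AlmostAbelian D) : (a + b).right = a.right + b.right := rfl

theorem left_zero : (0 : AlmostAbelian D).left = 0 := rfl

theorem right_zero : (0 : AlmostAbelian D).right = 0 := rfl

theorem left_smul (c : ℝ) (a : AlmostAbelian D) : (c • a).left = c • a.left := rfl

theorem right_smul (c : ℝ) (a : AlmostAbelian D) : (c • a).right = c * a.right := rfl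

theorem left_lie (a b : AlmostAbelian D) :
    ⁅a, b⁆.left = b.right • (D *ᵥ a.left) - a.right • (D *ᵥ b.left) := rfl

theorem right_lie (a b : AlmostAbelian D) : ⁅a, b⁆.right = 0 := rfl

noncomputable instance : LieRing (AlmostAbelian D) where
  add_lie a b c := by
    ext1
    · simp only [left_lie, left_add, right_add, Matrix.mulVec_add]
      module
    · simp only [right_lie, right_add, add_zero]
  lie_add a b c := by
    ext1
    · simp only [left_lie, left_add, right_add, Matrix.mulVec_add]
      module
    · simp only [right_lie, right_add, add_zero]
  lie_self a := by
    ext1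
    · simp only [left_lie, left_zero, sub_self]
    · simp only [right_lie, right_zero]
  leibniz_lie a b c := by
    ext1
    · simp only [left_lie, right_lie, left_add, Matrix.mulVec_sub, Matrix.mulVec_smul]
      module
    · simp only [right_lie, right_add, add_zero]

noncomputable instance : LieAlgebra ℝ (AlmostAbelian D) where
  lie_smul c a b := by
    ext1
    · simp only [left_lie, left_smul, right_smul, Matrix.mulVec_smul]
      module
    · simp only [right_lie, right_smul, mul_zero]

end AlmostAbelian

/-- `A_{3,2}`: `[f₁, f₃] = f₁`, `[f₂, f₃] = f₁ + f₂`. -/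
abbrev LieA32 : Type := AlmostAbelian !![1, 1; 0, 1]

/-- `A_{3,5}^α`: `[f₁, f₃] = f₁`, `[f₂, f₃] = α f₂`. -/
abbrev LieA35 (α : ℝ) : Type := AlmostAbelian !![1, 0; 0, α]

/-- `A_{4,2}^α`: `[f₁, f₄] = α f₁`, `[f₂, f₄] = f₂`, `[f₃, f₄] = f₂ + f₃`. -/
abbrev LieA42 (α : ℝ) : Type := AlmostAbelian !![α, 0, 0; 0, 1, 1; 0, 0, 1]

/-- `A_{4,4}`: `[f₁, f₄] = f₁`, `[f₂, f₄] = f₁ + f₂`, `[f₃, f₄] = f₂ + f₃`. -/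
abbrev LieA44 : Type := AlmostAbelian !![1, 1, 0; 0, 1, 1; 0, 0, 1]

/-- `A_{4,5}^{α,β}`: `[f₁, f₄] = f₁`, `[f₂, f₄] = α f₂`, `[f₃, f₄] = β f₃`. -/
abbrev LieA45 (α β : ℝ) : Type := AlmostAbelian !![1, 0, 0; 0, α, 0; 0, 0, β]

/-- `A_1`: the one-dimensional Lie algebra (`n = 0`: the basis is `f₁` alone, with zero bracket). -/
abbrev LieA1 : Type := AlmostAbelian (0 : Matrix (Fin 0) (Fin 0) ℝ)

/-! A symplectic form ω gives the generalized complex structure exchanging `g` and `g*` through ω,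
and a complex structure `J` gives `J ⊕ -J*`. The proof shows that every four-dimensional `g` has one
of these, unless it has an abelian ideal of codimension one on which a complementary vector acts by
a cyclic (nonderogatory) matrix with real eigenvalues `a, b, c`, no two of which have sum zero. Up
to scale and order these exceptions are the listed algebras, and for them an obstruction applies.

Obstruction. Let ε be the closed form whose kernel is the abelian ideal, `ε t = 1`, and `k = K ε`.
The torsion equations force `[t, k]` into the plane `⟨ε, k⟩`, and force `K` to carry suitable
eigenvectors of `[t, ·]` to eigenvectors with the same eigenvalue, modulo that plane
(`courantBracket_map_inr`, `courantBracket_map_of_eq`). On `ε^⊥ / ε` the eigenvalues of `[t, ·]` are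
`-a, -b, -c, a, b, c`, and `k` uses up one opposite pair. Among the remaining four some eigenspace
is a line, because the action is cyclic and no two of `a, b, c` are opposite. Then `K` has a real
eigenvector modulo a `K`-stable plane, against `K² = -1`
(`IsBidiagonal.not_isGeneralizedComplexStructure`).

Existence. Every `g` has a closed one-form with unimodular kernel (`exists_closed`), and the bracket
of a three-dimensional unimodular algebra is diagonal in a suitable basis (`exists_isMilnorBasis`).
If the kernel is not abelian, explicit symplectic forms and complex structures are available
according to the number of nonzero diagonal constants. If it is abelian, let `D` be the action of a
complement. A plane on which `D` is multiplication by a complex (possibly real) number yields a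
complex structure; such a plane exists unless `D` is cyclic with real eigenvalues. In that case two
opposite eigenvalues yield a symplectic form, and otherwise `g` is listed. -/

section Criteria

/-! ### Symplectic and complex structures as generalized complex structures. -/

variable {g : Type*} [LieRing g] [LieAlgebra ℝ g]

theorem coadjoint_apply (u : g) (β : Module.Dual ℝ g) (w : g) :
    coadjoint u β w = -β ⁅u, w⁆ := rfl

/-- A symplectic form on a Lie algebra defines a generalized complex structure. -/
theorem exists_isGeneralizedComplexStructure_of_symplectic [FiniteDimensional ℝ g]
    (ω : g →ₗ[ℝ] Module.Dual ℝ g) (skew : ∀ x y, ω x y = -ω y x)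
    (nondeg : ∀ x, ω x = 0 → x = 0)
    (closed : ∀ x y z, ω ⁅x, y⁆ z + ω ⁅y, z⁆ x + ω ⁅z, x⁆ y = 0) :
    ∃ K : Module.End ℝ (g × Module.Dual ℝ g), IsGeneralizedComplexStructure K := by
  have hinj : Function.Injective ω := (injective_iff_map_eq_zero ω).2 nondeg
  obtain ⟨Ω, hΩ⟩ : ∃ Ω : g ≃ₗ[ℝ] Module.Dual ℝ g, ∀ x, Ω x = ω x :=
    ⟨LinearMap.linearEquivOfInjective ω hinj Subspace.dual_finrank_eq.symm, fun _ => rfl⟩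
  have key : ∀ x y, Ω ⁅x, y⁆ = coadjoint x (Ω y) - coadjoint y (Ω x) := by
    intro x y
    ext w
    simp only [hΩ, LinearMap.sub_apply, coadjoint_apply]
    have h := closed x y w
    rw [skew y, skew x ⁅y, w⁆]
    rw [← lie_skew w x, map_neg, LinearMap.neg_apply] at h
    linarith
  have hneg : ∀ (x : g) (β : Module.Dual ℝ g), coadjoint (-x) β = -coadjoint x β := by
    intro x β; ext w; simp only [coadjoint_apply, neg_lie, map_neg, LinearMap.neg_apply]
  let K : Module.End ℝ (g × Module.Dual ℝ g) :=
    LinearMap.prod (-(Ω.symm.toLinearMap ∘ₗ LinearMap.snd ℝ g _))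
      (Ω.toLinearMap ∘ₗ LinearMap.fst ℝ g _)
  have hK : ∀ u x, K (u, Ω x) = (-x, Ω u) := by
    intro u x; simp [K]
  have hsurj : ∀ a : g × Module.Dual ℝ g, ∃ u x, a = (u, Ω x) := fun a =>
    ⟨a.1, Ω.symm a.2, by simp⟩
  refine ⟨K, ?_, ?_, ?_⟩
  · intro a
    obtain ⟨u, x, rfl⟩ := hsurj a
    rw [hK, hK]
    simp
  · intro a b
    obtain ⟨u, x, rfl⟩ := hsurj a
    obtain ⟨v, y, rfl⟩ := hsurj b
    rw [hK, hK]
    simp only [neutralMetric, map_neg, hΩ]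
    rw [skew v u, skew y x]
    ring
  · intro a b
    obtain ⟨u, x, rfl⟩ := hsurj a
    obtain ⟨v, y, rfl⟩ := hsurj b
    obtain ⟨p, hp⟩ := Ω.surjective (coadjoint (-x) (Ω y) - coadjoint v (Ω u))
    obtain ⟨q, hq⟩ := Ω.surjective (coadjoint u (Ω v) - coadjoint (-y) (Ω x))
    obtain ⟨r, hr⟩ := Ω.surjective (coadjoint u (Ω y) - coadjoint v (Ω x))
    simp only [courantNijenhuis, hK, courantBracket]
    rw [← hp, ← hq, ← hr]
    simp only [hK, map_neg]
    refine Prod.ext ?_ ?_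
    · apply Ω.injective
      simp only [Prod.fst_add, Prod.fst_sub, map_add, map_sub, map_neg, hp, hq, key, hneg,
        neg_lie, lie_neg, map_zero, Prod.fst_zero]
      abel
    · simp only [Prod.snd_add, Prod.snd_sub, map_neg, hr, key, hneg,
        neg_lie, lie_neg, Prod.snd_zero]
      abel

/-- A complex structure on a Lie algebra defines a generalized complex structure. -/
theorem exists_isGeneralizedComplexStructure_of_complex
    (J : g →ₗ[ℝ] g) (hJ : ∀ x, J (J x) = -x)
    (hN : ∀ x y, ⁅J x, J y⁆ - J ⁅J x, y⁆ - J ⁅x, J y⁆ - ⁅x, y⁆ = 0) :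
    ∃ K : Module.End ℝ (g × Module.Dual ℝ g), IsGeneralizedComplexStructure K := by
  let K : Module.End ℝ (g × Module.Dual ℝ g) :=
    LinearMap.prodMap J (-(LinearMap.lcomp ℝ ℝ J))
  have hK : ∀ u α, K (u, α) = (J u, -(α ∘ₗ J)) := fun u α => rfl
  refine ⟨K, ?_, ?_, ?_⟩
  · rintro ⟨u, α⟩
    rw [hK, hK]
    refine Prod.ext (hJ u) ?_
    ext w
    simp [hJ]
  · rintro ⟨u, α⟩ ⟨v, β⟩
    rw [hK, hK]
    simp only [neutralMetric, LinearMap.neg_apply, LinearMap.comp_apply]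
    ring
  · rintro ⟨u, α⟩ ⟨v, β⟩
    simp only [courantNijenhuis, hK, courantBracket]
    refine Prod.ext ?_ ?_
    · simp only [Prod.fst_add, Prod.fst_sub, hJ, Prod.fst_zero]
      rw [← hN u v]
      abel
    · ext w
      simp only [Prod.snd_add, Prod.snd_sub, Prod.snd_zero, LinearMap.add_apply,
        LinearMap.sub_apply, LinearMap.neg_apply, LinearMap.comp_apply, coadjoint_apply, hJ,
        LinearMap.zero_apply, map_neg]
      -- At `w` the covector part of the torsion is a combination of α and β applied to the
      -- Nijenhuis tensor of `J` at `(v, w)` and `(u, w)`.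
      have h1 := congrArg α (hN v w)
      have h2 := congrArg β (hN u w)
      simp only [map_sub, map_zero] at h1 h2
      linarith

/-- A complex structure given by a frame `v₁, J v₁, v₂, J v₂`: it is enough that the Nijenhuis
tensor vanishes on `(v₁, v₂)`. -/
theorem exists_isGeneralizedComplexStructure_of_complex_frame
    (b : Module.Basis (Fin 4) ℝ g) (p q r s : ℝ)
    (h₁ : ⁅b 0, b 2⁆ - ⁅b 1, b 3⁆ = p • b 0 + q • b 1 + r • b 2 + s • b 3)
    (h₂ : ⁅b 0, b 3⁆ + ⁅b 1, b 2⁆ = p • b 1 - q • b 0 + r • b 3 - s • b 2) :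
    ∃ K : Module.End ℝ (g × Module.Dual ℝ g), IsGeneralizedComplexStructure K := by
  let J : g →ₗ[ℝ] g := b.constr ℝ ![b 1, -b 0, b 3, -b 2]
  have J0 : J (b 0) = b 1 := by simp [J]
  have J1 : J (b 1) = -b 0 := by simp [J]
  have J2 : J (b 2) = b 3 := by simp [J]
  have J3 : J (b 3) = -b 2 := by simp [J]
  have hJ : ∀ x, J (J x) = -x := by
    have : J ∘ₗ J = -LinearMap.id := by
      refine b.ext fun i => ?_
      fin_cases i <;> simp [J0, J1, J2, J3]
    exact fun x => LinearMap.congr_fun this x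
  have h₃ : J (⁅b 0, b 2⁆ - ⁅b 1, b 3⁆) = ⁅b 0, b 3⁆ + ⁅b 1, b 2⁆ := by
    rw [h₁, h₂]
    simp only [map_add, map_smul, J0, J1, J2, J3]
    module
  have h₄ : J (⁅b 0, b 3⁆ + ⁅b 1, b 2⁆) = -(⁅b 0, b 2⁆ - ⁅b 1, b 3⁆) := by
    rw [← h₃, hJ]
  rw [map_sub] at h₃
  rw [map_add] at h₄
  let N : g →ₗ[ℝ] g →ₗ[ℝ] g := LinearMap.mk₂ ℝ
    (fun x y => ⁅J x, J y⁆ - J ⁅J x, y⁆ - J ⁅x, J y⁆ - ⁅x, y⁆)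
    (fun x x' y => by simp only [map_add, add_lie]; abel)
    (fun c x y => by simp only [map_smul, smul_lie, smul_sub])
    (fun x y y' => by simp only [map_add, lie_add]; abel)
    (fun c x y => by simp only [map_smul, lie_smul, smul_sub])
  have hNa : ∀ x y, N x y = ⁅J x, J y⁆ - J ⁅J x, y⁆ - J ⁅x, J y⁆ - ⁅x, y⁆ := fun _ _ => rfl
  have hswap : ∀ x y, N x y = 0 → N y x = 0 := by
    intro x y h
    rw [hNa] at h ⊢
    rw [← lie_skew (J y) (J x), ← lie_skew (J y) x, ← lie_skew y (J x), ← lie_skew y x, map_neg,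
      map_neg, ← neg_eq_zero, ← h]
    abel
  have hself : ∀ x, N x x = 0 := by
    intro x
    rw [hNa, ← lie_skew x (J x), map_neg, lie_self, lie_self]
    abel
  -- `N x (J y) = -J (N x y)`. With skew-symmetry, this carries the vanishing at `(b 0, b 2)` to all
  -- pairs of the frame.
  have hJr : ∀ x y, N x y = 0 → N x (J y) = 0 := by
    intro x y h
    have h' := congrArg J h
    rw [hNa] at h' ⊢
    simp only [hJ, map_sub, map_zero, lie_neg, map_neg] at h' ⊢
    rw [← neg_eq_zero, ← h']
    abel
  have h02 : N (b 0) (b 2) = 0 := by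
    rw [hNa, J0, J2]
    linear_combination (norm := abel) -h₄
  have h03 := hJr _ _ h02
  have h12 := hswap _ _ (hJr _ _ (hswap _ _ h02))
  have h13 := hswap _ _ (hJr _ _ (hswap _ _ h03))
  have h01 := hJr _ _ (hself (b 0))
  have h23 := hJr _ _ (hself (b 2))
  rw [J0] at h12 h13 h01
  rw [J2] at h03 h13 h23
  have hN : N = 0 := by
    refine b.ext fun i => b.ext fun j => ?_
    simp only [LinearMap.zero_apply]
    fin_cases i <;> fin_cases j <;>
      first
      | exact hself _
      | assumption
      | (apply hswap; assumption)
  refine exists_isGeneralizedComplexStructure_of_complex J hJ fun x y => ?_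
  rw [← hNa, hN]
  rfl

theorem eq_sum_four (b : Module.Basis (Fin 4) ℝ g) (x : g) :
    x = b.repr x 0 • b 0 + b.repr x 1 • b 1 + b.repr x 2 • b 2 + b.repr x 3 • b 3 := by
  conv_lhs => rw [← b.sum_repr x, Fin.sum_univ_four]

theorem lie_eq_sum_four (b : Module.Basis (Fin 4) ℝ g) (x y : g) :
    ⁅x, y⁆ = (b.repr x 0 * b.repr y 1 - b.repr x 1 * b.repr y 0) • ⁅b 0, b 1⁆
      + (b.repr x 0 * b.repr y 2 - b.repr x 2 * b.repr y 0) • ⁅b 0, b 2⁆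
      + (b.repr x 0 * b.repr y 3 - b.repr x 3 * b.repr y 0) • ⁅b 0, b 3⁆
      + (b.repr x 1 * b.repr y 2 - b.repr x 2 * b.repr y 1) • ⁅b 1, b 2⁆
      + (b.repr x 1 * b.repr y 3 - b.repr x 3 * b.repr y 1) • ⁅b 1, b 3⁆
      + (b.repr x 2 * b.repr y 3 - b.repr x 3 * b.repr y 2) • ⁅b 2, b 3⁆ := by
  conv_lhs => rw [eq_sum_four b x, eq_sum_four b y]
  simp only [add_lie, lie_add, smul_lie, lie_smul, lie_self]
  rw [← lie_skew (b 1) (b 0), ← lie_skew (b 2) (b 0), ← lie_skew (b 3) (b 0),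
    ← lie_skew (b 2) (b 1), ← lie_skew (b 3) (b 1), ← lie_skew (b 3) (b 2)]
  module

/-- A symplectic form given by its coefficients in a frame. -/
theorem exists_isGeneralizedComplexStructure_of_symplectic_frame
    (b : Module.Basis (Fin 4) ℝ g) (w₀₁ w₀₂ w₀₃ w₁₂ w₁₃ w₂₃ : ℝ)
    (hpf : w₀₁ * w₂₃ - w₀₂ * w₁₃ + w₀₃ * w₁₂ ≠ 0)
    (closed : ∀ ω : g →ₗ[ℝ] Module.Dual ℝ g, (∀ x, ω x x = 0) → ω (b 0) (b 1) = w₀₁ →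
      ω (b 0) (b 2) = w₀₂ → ω (b 0) (b 3) = w₀₃ → ω (b 1) (b 2) = w₁₂ → ω (b 1) (b 3) = w₁₃ →
      ω (b 2) (b 3) = w₂₃ → ω (b 1) (b 0) = -w₀₁ → ω (b 2) (b 0) = -w₀₂ →
      ω (b 3) (b 0) = -w₀₃ → ω (b 2) (b 1) = -w₁₂ → ω (b 3) (b 1) = -w₁₃ →
      ω (b 3) (b 2) = -w₂₃ →
      (ω ⁅b 0, b 1⁆ (b 2) + ω ⁅b 1, b 2⁆ (b 0) - ω ⁅b 0, b 2⁆ (b 1) = 0 ∧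
      ω ⁅b 0, b 1⁆ (b 3) + ω ⁅b 1, b 3⁆ (b 0) - ω ⁅b 0, b 3⁆ (b 1) = 0 ∧
      ω ⁅b 0, b 2⁆ (b 3) + ω ⁅b 2, b 3⁆ (b 0) - ω ⁅b 0, b 3⁆ (b 2) = 0 ∧
      ω ⁅b 1, b 2⁆ (b 3) + ω ⁅b 2, b 3⁆ (b 1) - ω ⁅b 1, b 3⁆ (b 2) = 0)) :
    ∃ K : Module.End ℝ (g × Module.Dual ℝ g), IsGeneralizedComplexStructure K := by
  have : FiniteDimensional ℝ g := b.finiteDimensional_of_finite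
  -- The form in coordinates. Since `closed` speaks of any alternating form with the prescribed
  -- values, its users only need to rewrite with these values.
  let f : g → g → ℝ := fun x y =>
    (b.repr x 0 * b.repr y 1 - b.repr x 1 * b.repr y 0) * w₀₁
      + (b.repr x 0 * b.repr y 2 - b.repr x 2 * b.repr y 0) * w₀₂
      + (b.repr x 0 * b.repr y 3 - b.repr x 3 * b.repr y 0) * w₀₃
      + (b.repr x 1 * b.repr y 2 - b.repr x 2 * b.repr y 1) * w₁₂
      + (b.repr x 1 * b.repr y 3 - b.repr x 3 * b.repr y 1) * w₁₃
      + (b.repr x 2 * b.repr y 3 - b.repr x 3 * b.repr y 2) * w₂₃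
  let ω : g →ₗ[ℝ] Module.Dual ℝ g := LinearMap.mk₂ ℝ f
    (fun x x' y => by simp only [f, map_add, Finsupp.add_apply]; ring)
    (fun c x y => by simp only [f, map_smul, Finsupp.smul_apply, smul_eq_mul]; ring)
    (fun x y y' => by simp only [f, map_add, Finsupp.add_apply]; ring)
    (fun c x y => by simp only [f, map_smul, Finsupp.smul_apply, smul_eq_mul]; ring)
  have hω : ∀ x y, ω x y = f x y := fun _ _ => rfl
  have skew : ∀ x y, ω x y = -ω y x := by
    intro x y; simp only [hω, f]; ring
  have alt : ∀ x, ω x x = 0 := fun x => by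
    have := skew x x
    linarith
  have e01 : ω (b 0) (b 1) = w₀₁ := by simp [hω, f]
  have e02 : ω (b 0) (b 2) = w₀₂ := by simp [hω, f]
  have e03 : ω (b 0) (b 3) = w₀₃ := by simp [hω, f]
  have e12 : ω (b 1) (b 2) = w₁₂ := by simp [hω, f]
  have e13 : ω (b 1) (b 3) = w₁₃ := by simp [hω, f]
  have e23 : ω (b 2) (b 3) = w₂₃ := by simp [hω, f]
  have e10 : ω (b 1) (b 0) = -w₀₁ := by rw [skew, e01]
  have e20 : ω (b 2) (b 0) = -w₀₂ := by rw [skew, e02]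
  have e30 : ω (b 3) (b 0) = -w₀₃ := by rw [skew, e03]
  have e21 : ω (b 2) (b 1) = -w₁₂ := by rw [skew, e12]
  have e31 : ω (b 3) (b 1) = -w₁₃ := by rw [skew, e13]
  have e32 : ω (b 3) (b 2) = -w₂₃ := by rw [skew, e23]
  obtain ⟨t012, t013, t023, t123⟩ :=
    closed ω alt e01 e02 e03 e12 e13 e23 e10 e20 e30 e21 e31 e32
  refine exists_isGeneralizedComplexStructure_of_symplectic ω skew ?_ ?_
  · intro x hx
    have hx' : ∀ y, ω x y = 0 := fun y => by rw [hx]; rfl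
    have h0 := hx' (b 0)
    have h1 := hx' (b 1)
    have h2 := hx' (b 2)
    have h3 := hx' (b 3)
    rw [eq_sum_four b x] at h0 h1 h2 h3
    simp only [map_add, map_smul, LinearMap.add_apply, LinearMap.smul_apply, smul_eq_mul, alt,
      e01, e02, e03, e12, e13, e23, e10, e20, e30, e21, e31, e32] at h0 h1 h2 h3
    rw [eq_sum_four b x]
    -- The coefficients here and below are the rows of the Pfaffian adjugate of the skew matrix `w`,
    -- whose product with `w` is a scalar matrix given by the Pfaffian up to sign.
    have x0 : b.repr x 0 = 0 := by
      refine (mul_eq_zero.1 ?_).resolve_right hpf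
      linear_combination w₂₃ * h1 - w₁₃ * h2 + w₁₂ * h3
    have x1 : b.repr x 1 = 0 := by
      refine (mul_eq_zero.1 ?_).resolve_right hpf
      linear_combination -w₂₃ * h0 + w₀₃ * h2 - w₀₂ * h3
    have x2 : b.repr x 2 = 0 := by
      refine (mul_eq_zero.1 ?_).resolve_right hpf
      linear_combination w₁₃ * h0 - w₀₃ * h1 + w₀₁ * h3
    have x3 : b.repr x 3 = 0 := by
      refine (mul_eq_zero.1 ?_).resolve_right hpf
      linear_combination -w₁₂ * h0 + w₀₂ * h1 - w₀₁ * h2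
    simp [x0, x1, x2, x3]
  -- `T` is the differential of ω up to sign. It is alternating and linear in its last argument, so
  -- its four values on triples of distinct basis vectors determine it.
  · let T : g → g → g →ₗ[ℝ] ℝ := fun x y =>
      ω ⁅x, y⁆ + ω.flip x ∘ₗ (LieAlgebra.ad ℝ g y : g →ₗ[ℝ] g)
        - ω.flip y ∘ₗ (LieAlgebra.ad ℝ g x : g →ₗ[ℝ] g)
    have hT : ∀ x y z, T x y z = ω ⁅x, y⁆ z + ω ⁅y, z⁆ x - ω ⁅x, z⁆ y := fun _ _ _ => rfl
    have hcyc : ∀ x y z, T x y z = T y z x := by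
      intro x y z
      rw [hT, hT, ← lie_skew x z, ← lie_skew x y]
      simp only [map_neg, LinearMap.neg_apply]
      ring
    have hswap : ∀ x y z, T x y z = -T y x z := by
      intro x y z
      rw [hT, hT, ← lie_skew x y]
      simp only [map_neg, LinearMap.neg_apply]
      ring
    have hself : ∀ x z, T x x z = 0 := fun x z => by
      have := hswap x x z
      linarith
    have ext4 : ∀ f : g →ₗ[ℝ] ℝ, f (b 0) = 0 → f (b 1) = 0 → f (b 2) = 0 → f (b 3) = 0 →
        ∀ z, f z = 0 := by
      intro f h0 h1 h2 h3 z
      rw [eq_sum_four b z]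
      simp [h0, h1, h2, h3]
    have hself' : ∀ x z, T x z x = 0 := fun x z => by rw [hcyc, hcyc, hself]
    have hself'' : ∀ x z, T z x x = 0 := fun x z => by rw [hcyc, hself]
    have s012 : T (b 0) (b 1) (b 2) = 0 := by rw [hT]; linarith
    have s013 : T (b 0) (b 1) (b 3) = 0 := by rw [hT]; linarith
    have s023 : T (b 0) (b 2) (b 3) = 0 := by rw [hT]; linarith
    have s123 : T (b 1) (b 2) (b 3) = 0 := by rw [hT]; linarith
    have s021 : T (b 0) (b 2) (b 1) = 0 := by rw [hcyc, hcyc, hswap, s012, neg_zero]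
    have s031 : T (b 0) (b 3) (b 1) = 0 := by rw [hcyc, hcyc, hswap, s013, neg_zero]
    have s032 : T (b 0) (b 3) (b 2) = 0 := by rw [hcyc, hcyc, hswap, s023, neg_zero]
    have s120 : T (b 1) (b 2) (b 0) = 0 := by rw [← hcyc, s012]
    have s130 : T (b 1) (b 3) (b 0) = 0 := by rw [← hcyc, s013]
    have s132 : T (b 1) (b 3) (b 2) = 0 := by rw [hcyc, hcyc, hswap, s123, neg_zero]
    have s230 : T (b 2) (b 3) (b 0) = 0 := by rw [← hcyc, s023]
    have s231 : T (b 2) (b 3) (b 1) = 0 := by rw [← hcyc, s123]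
    have h01 : ∀ z, T (b 0) (b 1) z = 0 := ext4 _ (hself' _ _) (hself'' _ _) s012 s013
    have h02 : ∀ z, T (b 0) (b 2) z = 0 := ext4 _ (hself' _ _) s021 (hself'' _ _) s023
    have h03 : ∀ z, T (b 0) (b 3) z = 0 := ext4 _ (hself' _ _) s031 s032 (hself'' _ _)
    have h12 : ∀ z, T (b 1) (b 2) z = 0 := ext4 _ s120 (hself' _ _) (hself'' _ _) s123
    have h13 : ∀ z, T (b 1) (b 3) z = 0 := ext4 _ s130 (hself' _ _) s132 (hself'' _ _)
    have h23 : ∀ z, T (b 2) (b 3) z = 0 := ext4 _ s230 s231 (hself' _ _) (hself'' _ _)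
    intro x y z
    have h0 : ∀ y, T y z (b 0) = 0 := fun y => by
      rw [hcyc]
      refine ext4 _ ?_ ?_ ?_ ?_ y <;> rw [hcyc]
      exacts [hself _ _, h01 _, h02 _, h03 _]
    have h1 : ∀ y, T y z (b 1) = 0 := fun y => by
      rw [hcyc]
      refine ext4 _ ?_ ?_ ?_ ?_ y <;> rw [hcyc]
      exacts [by rw [hswap, h01, neg_zero], hself _ _, h12 _, h13 _]
    have h2 : ∀ y, T y z (b 2) = 0 := fun y => by
      rw [hcyc]
      refine ext4 _ ?_ ?_ ?_ ?_ y <;> rw [hcyc]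
      exacts [by rw [hswap, h02, neg_zero], by rw [hswap, h12, neg_zero], hself _ _, h23 _]
    have h3 : ∀ y, T y z (b 3) = 0 := fun y => by
      rw [hcyc]
      refine ext4 _ ?_ ?_ ?_ ?_ y <;> rw [hcyc]
      exacts [by rw [hswap, h03, neg_zero], by rw [hswap, h13, neg_zero],
        by rw [hswap, h23, neg_zero], hself _ _]
    have h : T x y z = 0 := by
      rw [hcyc]
      exact ext4 _ (h0 y) (h1 y) (h2 y) (h3 y) x
    rw [hT, ← lie_skew x z, map_neg, LinearMap.neg_apply] at h
    linarith

end Criteria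

/-! ### Torsion equations relative to an abelian ideal of codimension one. -/

section Obstruction

variable {g : Type*} [LieRing g] [LieAlgebra ℝ g]

theorem exists_basis_of_linearIndependent_four (e : Module.Basis (Fin 4) ℝ g) (v₀ v₁ v₂ v₃ : g)
    (h : ∀ c₀ c₁ c₂ c₃ : ℝ, c₀ • v₀ + c₁ • v₁ + c₂ • v₂ + c₃ • v₃ = 0 →
      c₀ = 0 ∧ c₁ = 0 ∧ c₂ = 0 ∧ c₃ = 0) :
    ∃ b : Module.Basis (Fin 4) ℝ g, b 0 = v₀ ∧ b 1 = v₁ ∧ b 2 = v₂ ∧ b 3 = v₃ := by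
  have hli : LinearIndependent ℝ ![v₀, v₁, v₂, v₃] := by
    rw [Fintype.linearIndependent_iff]
    intro c hc i
    obtain ⟨h0, h1, h2, h3⟩ := h (c 0) (c 1) (c 2) (c 3)
      (by simpa [Fin.sum_univ_four] using hc)
    fin_cases i <;> assumption
  have hcard : Fintype.card (Fin 4) = Module.finrank ℝ g := by
    rw [Module.finrank_eq_card_basis e]
  refine ⟨basisOfLinearIndependentOfCardEqFinrank hli hcard, ?_⟩
  simp

theorem coeffs_eq_zero (e : Module.Basis (Fin 4) ℝ g) {c₀ c₁ c₂ c₃ : ℝ}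
    (h : c₀ • e 0 + c₁ • e 1 + c₂ • e 2 + c₃ • e 3 = 0) :
    c₀ = 0 ∧ c₁ = 0 ∧ c₂ = 0 ∧ c₃ = 0 := by
  have hli := Fintype.linearIndependent_iff.1 e.linearIndependent ![c₀, c₁, c₂, c₃]
    (by simpa [Fin.sum_univ_four] using h)
  exact ⟨hli 0, hli 1, hli 2, hli 3⟩

theorem coeffs_eq (e : Module.Basis (Fin 4) ℝ g) {c₀ c₁ c₂ c₃ d₀ d₁ d₂ d₃ : ℝ}
    (h : c₀ • e 0 + c₁ • e 1 + c₂ • e 2 + c₃ • e 3 = d₀ • e 0 + d₁ • e 1 + d₂ • e 2 + d₃ • e 3) :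
    c₀ = d₀ ∧ c₁ = d₁ ∧ c₂ = d₂ ∧ c₃ = d₃ := by
  have h' : (c₀ - d₀) • e 0 + (c₁ - d₁) • e 1 + (c₂ - d₂) • e 2 + (c₃ - d₃) • e 3 = 0 := by
    rw [← sub_eq_zero] at h
    rw [← h]
    module
  obtain ⟨h0, h1, h2, h3⟩ := coeffs_eq_zero e h'
  exact ⟨sub_eq_zero.1 h0, sub_eq_zero.1 h1, sub_eq_zero.1 h2, sub_eq_zero.1 h3⟩

/-! ### Algebra of the Courant bracket -/

theorem courantBracket_add_smul_left (s : ℝ) (a a' b : g × Module.Dual ℝ g) :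
    courantBracket (s • a + a') b = s • courantBracket a b + courantBracket a' b := by
  refine Prod.ext ?_ ?_
  · simp [courantBracket]
  · ext w
    simp [courantBracket, coadjoint]
    ring

theorem courantBracket_swap (a b : g × Module.Dual ℝ g) :
    courantBracket a b = -courantBracket b a := by
  refine Prod.ext ?_ ?_
  · simp [courantBracket]
  · simp [courantBracket]

section Codimension

variable {ε : Module.Dual ℝ g} {t : g}

/-- Closed one-forms are central in `Φ(g)`: the coadjoint action sends ε to `-ε ⁅v, ·⁆ = 0`. -/
theorem courantBracket_inr (hε : ∀ u v : g, ε ⁅u, v⁆ = 0) (b : g × Module.Dual ℝ g) :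
    courantBracket ((0 : g), ε) b = 0 := by
  refine Prod.ext ?_ ?_
  · simp [courantBracket]
  · ext w
    simp [courantBracket, coadjoint, hε]

/-- `ε y.1 = 0` means that `y` is orthogonal to ε. For `u` in the abelian ideal `ker ε`, the
covector `coadjoint u β` vanishes on `ker ε`, hence is a multiple of ε. -/
theorem courantBracket_eq_smul_of_mem_ker (ht : ε t = 1)
    (hab : ∀ u v : g, ε u = 0 → ε v = 0 → ⁅u, v⁆ = 0) {y z : g × Module.Dual ℝ g}
    (hy : ε y.1 = 0) (hz : ε z.1 = 0) :
    ∃ r : ℝ, courantBracket y z = r • ((0 : g), ε) := by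
  have key : ∀ (u : g) (β : Module.Dual ℝ g), ε u = 0 → coadjoint u β = (-β ⁅u, t⁆) • ε := by
    intro u β hu
    ext w
    have hw : ε (w - ε w • t) = 0 := by simp [ht]
    have h := hab u _ hu hw
    rw [lie_sub, lie_smul, sub_eq_zero] at h
    simp only [coadjoint_apply, LinearMap.smul_apply, smul_eq_mul, h, map_smul]
    ring
  refine ⟨-z.2 ⁅y.1, t⁆ + y.2 ⁅z.1, t⁆, Prod.ext ?_ ?_⟩
  · simp [courantBracket, hab _ _ hy hz]
  · simp only [courantBracket, key _ _ hy, key _ _ hz, Prod.smul_snd]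
    module

variable {K : Module.End ℝ (g × Module.Dual ℝ g)}

theorem neutralMetric_inr_left (y : g × Module.Dual ℝ g) :
    neutralMetric ((0 : g), ε) y = (1 / 2) * ε y.1 := by
  simp [neutralMetric]

theorem neutralMetric_comm (x y : g × Module.Dual ℝ g) :
    neutralMetric x y = neutralMetric y x := by
  simp only [neutralMetric]
  ring

theorem neutralMetric_neg_left (x y : g × Module.Dual ℝ g) :
    neutralMetric (-x) y = -neutralMetric x y := by
  simp only [neutralMetric, Prod.fst_neg, Prod.snd_neg, LinearMap.neg_apply, map_neg]
  ring

theorem IsGeneralizedComplexStructure.neutralMetric_map_map (hK : IsGeneralizedComplexStructure K)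
    (x y : g × Module.Dual ℝ g) : neutralMetric (K x) (K y) = neutralMetric x y := by
  have h := hK.skew x (K y)
  rw [hK.sq_eq_neg_one, neutralMetric_neg_left, neutralMetric_comm y x] at h
  linarith

theorem IsGeneralizedComplexStructure.apply_fst_map_inr (hK : IsGeneralizedComplexStructure K) :
    ε (K ((0 : g), ε)).1 = 0 := by
  have h := hK.skew ((0 : g), ε) ((0 : g), ε)
  rw [neutralMetric_comm, neutralMetric_inr_left] at h
  linarith

theorem IsGeneralizedComplexStructure.apply_fst_map (hK : IsGeneralizedComplexStructure K)
    {y : g × Module.Dual ℝ g} (hy : neutralMetric (K ((0 : g), ε)) y = 0) :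
    ε (K y).1 = 0 := by
  have h := hK.skew ((0 : g), ε) y
  rw [hy, neutralMetric_comm, neutralMetric_inr_left] at h
  linarith

theorem eq_smul_add_of_apply_eq_one (ht : ε t = 1) (x : g × Module.Dual ℝ g) :
    ∃ (s : ℝ) (z : g × Module.Dual ℝ g), x = s • (t, (0 : Module.Dual ℝ g)) + z ∧ ε z.1 = 0 := by
  refine ⟨ε x.1, x - ε x.1 • (t, (0 : Module.Dual ℝ g)), by abel, ?_⟩
  simp [ht]

/-- Write `K t = s t + z` with `z` orthogonal to ε. As ε is central, the torsion at `(t, ε)` says `K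
X = s X + r ε` for `X = [t, K ε]`. Applying `K` once more gives `(1 + s²) X` in the plane `⟨ε, K
ε⟩`, and `1 + s²` is invertible. -/
theorem IsGeneralizedComplexStructure.courantBracket_map_inr (hK : IsGeneralizedComplexStructure K)
    (ht : ε t = 1) (hε : ∀ u v : g, ε ⁅u, v⁆ = 0)
    (hab : ∀ u v : g, ε u = 0 → ε v = 0 → ⁅u, v⁆ = 0) :
    ∃ p q : ℝ, courantBracket (t, (0 : Module.Dual ℝ g)) (K ((0 : g), ε)) =
      p • ((0 : g), ε) + q • K ((0 : g), ε) := by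
  obtain ⟨s, z, hs, hz⟩ := eq_smul_add_of_apply_eq_one ht (K (t, (0 : Module.Dual ℝ g)))
  obtain ⟨r, hr⟩ := courantBracket_eq_smul_of_mem_ker ht hab hz
    (hK.apply_fst_map_inr (ε := ε))
  have hN := hK.torsion_eq_zero (t, (0 : Module.Dual ℝ g)) ((0 : g), ε)
  rw [courantNijenhuis, courantBracket_swap (K (t, 0)) ((0 : g), ε),
    courantBracket_swap (t, 0) ((0 : g), ε), courantBracket_inr hε, courantBracket_inr hε,
    neg_zero, map_zero, map_zero, hs, courantBracket_add_smul_left, hr] at hN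
  set X := courantBracket (t, (0 : Module.Dual ℝ g)) (K ((0 : g), ε))
  set k := K ((0 : g), ε) with hk
  have h1 : K X = s • X + r • ((0 : g), ε) := by
    rw [← sub_eq_zero, ← neg_eq_zero, ← hN]
    abel
  have h2 := congrArg K h1
  rw [hK.sq_eq_neg_one, map_add, map_smul, map_smul, h1, ← hk] at h2
  have h3 : (1 + s ^ 2) • X = (-(s * r)) • ((0 : g), ε) + (-r) • k := by
    linear_combination (norm := module) -h2
  have hs0 : (1 + s ^ 2) ≠ 0 := by positivity
  refine ⟨(1 + s ^ 2)⁻¹ * (-(s * r)), (1 + s ^ 2)⁻¹ * (-r), ?_⟩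
  rw [← inv_smul_smul₀ hs0 X, h3]
  module

/-- On an eigenvector orthogonal to the plane `⟨ε, K ε⟩`, `K` commutes with `[t, ·]` modulo this
plane. The defect `Z = [t, K y] - μ K y` satisfies `K Z = s Z` modulo the plane, and `K` has no real
eigenvalue on the quotient. -/
theorem IsGeneralizedComplexStructure.courantBracket_map_of_eq
    (hK : IsGeneralizedComplexStructure K)
    (ht : ε t = 1) (hab : ∀ u v : g, ε u = 0 → ε v = 0 → ⁅u, v⁆ = 0)
    {y : g × Module.Dual ℝ g} (hy : ε y.1 = 0) (hy' : neutralMetric (K ((0 : g), ε)) y = 0)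
    {μ p q : ℝ} (h : courantBracket (t, (0 : Module.Dual ℝ g)) y =
      μ • y + p • ((0 : g), ε) + q • K ((0 : g), ε)) :
    ∃ p' q' : ℝ, courantBracket (t, (0 : Module.Dual ℝ g)) (K y) =
      μ • K y + p' • ((0 : g), ε) + q' • K ((0 : g), ε) := by
  obtain ⟨s, z, hs, hz⟩ := eq_smul_add_of_apply_eq_one ht (K (t, (0 : Module.Dual ℝ g)))
  obtain ⟨r, hr⟩ := courantBracket_eq_smul_of_mem_ker ht hab hz (hK.apply_fst_map hy')
  obtain ⟨r', hr'⟩ := courantBracket_eq_smul_of_mem_ker ht hab hz hy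
  have hN := hK.torsion_eq_zero (t, (0 : Module.Dual ℝ g)) y
  rw [courantNijenhuis, hK.sq_eq_neg_one, hs, courantBracket_add_smul_left,
    courantBracket_add_smul_left, hr, hr', h] at hN
  set X := courantBracket (t, (0 : Module.Dual ℝ g)) (K y)
  simp only [map_add, map_smul, hK.sq_eq_neg_one] at hN
  set k := K ((0 : g), ε) with hk
  obtain ⟨m, n, h1⟩ : ∃ m n : ℝ, K (X - μ • K y) =
      s • (X - μ • K y) + m • ((0 : g), ε) + n • k := by
    refine ⟨r + s * q - p, -(s * p) - r' - q, ?_⟩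
    rw [map_sub, map_smul, hK.sq_eq_neg_one]
    linear_combination (norm := module) -hN
  set Z := X - μ • K y with hZ
  have h2 := congrArg K h1
  rw [hK.sq_eq_neg_one, map_add, map_add, map_smul, map_smul, map_smul, h1, ← hk, hk,
    hK.sq_eq_neg_one, ← hk] at h2
  have h3 : (1 + s ^ 2) • Z = (n - s * m) • ((0 : g), ε) + (-(s * n) - m) • k := by
    linear_combination (norm := module) -h2
  have hs0 : (1 + s ^ 2) ≠ 0 := by positivity
  refine ⟨(1 + s ^ 2)⁻¹ * (n - s * m), (1 + s ^ 2)⁻¹ * (-(s * n) - m), ?_⟩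
  rw [add_assoc, ← sub_eq_iff_eq_add', ← hZ, ← inv_smul_smul₀ hs0 Z, h3]
  module

end Codimension

end Obstruction

/-! ### Obstruction for a cyclic action with real eigenvalues. -/

section Bidiagonal

variable {g : Type*} [LieRing g] [LieAlgebra ℝ g]

/-- The basis `e` spans an abelian ideal with `e 0, e 1, e 2`, on which the bracket with `e 3` is
bidiagonal with diagonal `a, b, c`. -/
structure IsBidiagonal (e : Module.Basis (Fin 4) ℝ g) (a b c : ℝ) : Prop where
  lie01 : ⁅e 0, e 1⁆ = 0
  lie02 : ⁅e 0, e 2⁆ = 0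
  lie12 : ⁅e 1, e 2⁆ = 0
  lie03 : ⁅e 0, e 3⁆ = a • e 0
  lie13 : ⁅e 1, e 3⁆ = e 0 + b • e 1
  lie23 : ⁅e 2, e 3⁆ = e 1 + c • e 2

/-- The functional `ε` is the last one of the dual basis. -/
structure IsLastCoord (ε : Module.Dual ℝ g) (e : Module.Basis (Fin 4) ℝ g) : Prop where
  apply0 : ε (e 0) = 0
  apply1 : ε (e 1) = 0
  apply2 : ε (e 2) = 0
  apply3 : ε (e 3) = 1

variable {e : Module.Basis (Fin 4) ℝ g} {a b c : ℝ} {ε : Module.Dual ℝ g}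

theorem IsLastCoord.apply (hε : IsLastCoord ε e) (u : g) : ε u = e.repr u 3 := by
  conv_lhs => rw [eq_sum_four e u]
  simp [hε.apply0, hε.apply1, hε.apply2, hε.apply3]

/-- The eigenvalues of a bidiagonal matrix with ones off the diagonal can be put in any order: `e 0
+ (b - a) • e 1` is an eigenvector for `b`. Nothing is divided by `b - a`, so equal entries are
allowed. -/
theorem IsBidiagonal.swap_left (he : IsBidiagonal e a b c) (hε : IsLastCoord ε e) :
    ∃ e' : Module.Basis (Fin 4) ℝ g, IsBidiagonal e' b a c ∧ IsLastCoord ε e' ∧ e' 3 = e 3 := by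
  obtain ⟨f, h0, h1, h2, h3⟩ := exists_basis_of_linearIndependent_four e
    (e 0 + (b - a) • e 1) (e 1) (e 2) (e 3) (fun c₀ c₁ c₂ c₃ h => by
      obtain ⟨k0, k1, k2, k3⟩ := coeffs_eq_zero e (c₀ := c₀) (c₁ := c₁ + c₀ * (b - a)) (c₂ := c₂)
        (c₃ := c₃) (by rw [← h]; module)
      subst k0
      exact ⟨rfl, by simpa using k1, k2, k3⟩)
  refine ⟨f, ⟨?_, ?_, ?_, ?_, ?_, ?_⟩, ⟨?_, ?_, ?_, ?_⟩, h3⟩ <;>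
    simp only [h0, h1, h2, h3, add_lie, smul_lie, he.lie01, he.lie02, he.lie12, he.lie03, he.lie13,
      he.lie23, map_add, map_smul, hε.apply0, hε.apply1, hε.apply2, hε.apply3, lie_self] <;>
    module

theorem IsBidiagonal.swap_right (he : IsBidiagonal e a b c) (hε : IsLastCoord ε e) :
    ∃ e' : Module.Basis (Fin 4) ℝ g, IsBidiagonal e' a c b ∧ IsLastCoord ε e' ∧ e' 3 = e 3 := by
  obtain ⟨f, h0, h1, h2, h3⟩ := exists_basis_of_linearIndependent_four e
    (e 0) (e 1 + (c - b) • e 2) (e 2) (e 3) (fun c₀ c₁ c₂ c₃ h => by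
      obtain ⟨k0, k1, k2, k3⟩ := coeffs_eq_zero e (c₀ := c₀) (c₁ := c₁) (c₂ := c₂ + c₁ * (c - b))
        (c₃ := c₃) (by rw [← h]; module)
      subst k1
      exact ⟨k0, rfl, by simpa using k2, k3⟩)
  refine ⟨f, ⟨?_, ?_, ?_, ?_, ?_, ?_⟩, ⟨?_, ?_, ?_, ?_⟩, h3⟩ <;>
    simp only [h0, h1, h2, h3, add_lie, lie_add, lie_smul, smul_lie, he.lie01, he.lie02, he.lie12,
      he.lie03, he.lie13, he.lie23, map_add, map_smul, hε.apply0, hε.apply1, hε.apply2,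
      hε.apply3, lie_self] <;>
    module

theorem IsBidiagonal.lie_left (he : IsBidiagonal e a b c) (u : g) :
    ⁅e 3, u⁆ = (-(a * e.repr u 0 + e.repr u 1)) • e 0 + (-(b * e.repr u 1 + e.repr u 2)) • e 1 +
      (-(c * e.repr u 2)) • e 2 + (0 : ℝ) • e 3 := by
  rw [lie_eq_sum_four e, he.lie01, he.lie02, he.lie12, he.lie03, he.lie13, he.lie23]
  simp only [Module.Basis.repr_self, Finsupp.single_apply]
  simp only [Fin.reduceEq, if_true, if_false]
  module

theorem IsBidiagonal.apply_lie (he : IsBidiagonal e a b c) (hε : IsLastCoord ε e) (u v : g) :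
    ε ⁅u, v⁆ = 0 := by
  rw [lie_eq_sum_four e, he.lie01, he.lie02, he.lie12, he.lie03, he.lie13, he.lie23]
  simp [hε.apply0, hε.apply1, hε.apply2]

theorem IsBidiagonal.lie_eq_zero (he : IsBidiagonal e a b c) (hε : IsLastCoord ε e) (u v : g)
    (hu : ε u = 0) (hv : ε v = 0) : ⁅u, v⁆ = 0 := by
  rw [hε.apply] at hu hv
  rw [lie_eq_sum_four e, he.lie01, he.lie02, he.lie12, hu, hv]
  simp

variable {K : Module.End ℝ (g × Module.Dual ℝ g)}

/-- The components of an equation `[e₃, y] = μ y + p ε + q k`. -/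
theorem IsBidiagonal.eq_components (he : IsBidiagonal e a b c) (hε : IsLastCoord ε e)
    {y k : g × Module.Dual ℝ g} {μ p q : ℝ}
    (h : courantBracket (e 3, (0 : Module.Dual ℝ g)) y = μ • y + p • ((0 : g), ε) + q • k) :
    (-(a * e.repr y.1 0 + e.repr y.1 1) = μ * e.repr y.1 0 + q * e.repr k.1 0 ∧
      -(b * e.repr y.1 1 + e.repr y.1 2) = μ * e.repr y.1 1 + q * e.repr k.1 1 ∧
      -(c * e.repr y.1 2) = μ * e.repr y.1 2 + q * e.repr k.1 2) ∧
    (a * y.2 (e 0) = μ * y.2 (e 0) + q * k.2 (e 0) ∧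
      y.2 (e 0) + b * y.2 (e 1) = μ * y.2 (e 1) + q * k.2 (e 1) ∧
      y.2 (e 1) + c * y.2 (e 2) = μ * y.2 (e 2) + q * k.2 (e 2)) := by
  have h1 := congrArg Prod.fst h
  have h2 := congrArg Prod.snd h
  simp only [courantBracket, Prod.fst_add, Prod.snd_add, Prod.smul_fst, Prod.smul_snd, smul_zero,
    add_zero] at h1 h2
  rw [he.lie_left, eq_sum_four e k.1] at h1
  conv_rhs at h1 => rw [eq_sum_four e y.1]
  obtain ⟨k0, k1, k2, -⟩ := coeffs_eq e (d₀ := μ * e.repr y.1 0 + q * e.repr k.1 0)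
    (d₁ := μ * e.repr y.1 1 + q * e.repr k.1 1) (d₂ := μ * e.repr y.1 2 + q * e.repr k.1 2)
    (d₃ := μ * e.repr y.1 3 + q * e.repr k.1 3) (h1.trans (by module))
  refine ⟨⟨k0, k1, k2⟩, ?_⟩
  have h0' := LinearMap.congr_fun h2 (e 0)
  have h1' := LinearMap.congr_fun h2 (e 1)
  have h2' := LinearMap.congr_fun h2 (e 2)
  rw [LinearMap.sub_apply, coadjoint_apply, coadjoint_apply, ← lie_skew] at h0' h1' h2'
  rw [he.lie03] at h0'
  rw [he.lie13] at h1'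
  rw [he.lie23] at h2'
  simp only [LinearMap.zero_apply, neg_zero, sub_zero, map_neg, neg_neg, map_smul, map_add,
    smul_eq_mul, LinearMap.add_apply, LinearMap.smul_apply, hε.apply0, hε.apply1, hε.apply2,
    mul_zero, add_zero] at h0' h1' h2'
  exact ⟨h0', h1', h2'⟩

/-- The plane `⟨ε, K ε⟩` is stable under `K`, and `y` would be a real eigenvector in the quotient.
The functional `φ` vanishes on the vector parts of the plane and not on that of `y`, so it reads off
`v² = -1`. -/
theorem sq_eq_neg_one_of_map_eq (hK : IsGeneralizedComplexStructure K)
    {y : g × Module.Dual ℝ g} {v m n : ℝ} (h : K y = v • y + m • ((0 : g), ε) + n • K ((0 : g), ε))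
    (φ : Module.Dual ℝ g) (h1 : φ y.1 = 1) (h2 : φ (K ((0 : g), ε)).1 = 0) : False := by
  have h3 := congrArg K h
  rw [hK.sq_eq_neg_one, map_add, map_add, map_smul, map_smul, map_smul, hK.sq_eq_neg_one, h] at h3
  have h4 := congrArg (fun x : g × Module.Dual ℝ g => φ x.1) h3
  simp [h1, h2] at h4
  nlinarith [sq_nonneg v]

/-- Here `k` is a combination of `e 0` and ε. In the quotient of the orthogonal of `⟨ε, k⟩` by this
plane, `[e 3, ·]` has eigenvalues `-b, -c, b, c`. Since `b ≠ 0` and `b + c ≠ 0`, its eigenspace for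
`-b` is the line of `e 1`, even when `b = c`, and `K` preserves it. -/
theorem IsBidiagonal.false_of_fst (he : IsBidiagonal e a b c) (hε : IsLastCoord ε e)
    (hK : IsGeneralizedComplexStructure K) (hb : b ≠ 0) (hbc : b + c ≠ 0)
    (h1 : e.repr (K ((0 : g), ε)).1 1 = 0) (h2 : e.repr (K ((0 : g), ε)).1 2 = 0)
    (h0 : e.repr (K ((0 : g), ε)).1 0 ≠ 0)
    (x0 : (K ((0 : g), ε)).2 (e 0) = 0) (x1 : (K ((0 : g), ε)).2 (e 1) = 0)
    (x2 : (K ((0 : g), ε)).2 (e 2) = 0) : False := by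
  have hk3 : e.repr (K ((0 : g), ε)).1 3 = 0 := by
    rw [← hε.apply]
    exact hK.apply_fst_map_inr
  set k := K ((0 : g), ε) with hk
  have hk1 : k.1 = e.repr k.1 0 • e 0 := by
    conv_lhs => rw [eq_sum_four e k.1, h1, h2, hk3]
    module
  have dual : ∀ β : Module.Dual ℝ g, β (e 0) = 0 → β (e 1) = 0 → β (e 2) = 0 →
      β = β (e 3) • ε := by
    intro β b0 b1 b2
    refine e.ext fun i => ?_
    fin_cases i <;> simp [b0, b1, b2, hε.apply0, hε.apply1, hε.apply2, hε.apply3]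
  have hk2 := dual k.2 x0 x1 x2
  set r := e.repr k.1 0
  set τ := k.2 (e 3)
  have hkk : k = r • (e 0, (0 : Module.Dual ℝ g)) + τ • ((0 : g), ε) := by
    refine Prod.ext ?_ ?_
    · simpa using hk1
    · simpa using hk2
  have he0 : (e 0, (0 : Module.Dual ℝ g)) = r⁻¹ • k + (-(r⁻¹ * τ)) • ((0 : g), ε) := by
    rw [hkk, smul_add, inv_smul_smul₀ h0]
    module
  have hy1 : courantBracket (e 3, (0 : Module.Dual ℝ g)) (e 1, (0 : Module.Dual ℝ g)) =
      (-b) • (e 1, (0 : Module.Dual ℝ g)) + (r⁻¹ * τ) • ((0 : g), ε) + (-r⁻¹) • k := by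
    have : courantBracket (e 3, (0 : Module.Dual ℝ g)) (e 1, (0 : Module.Dual ℝ g)) =
      (-b) • (e 1, (0 : Module.Dual ℝ g)) - (e 0, (0 : Module.Dual ℝ g)) := by
      refine Prod.ext ?_ ?_
      · simp only [courantBracket]
        rw [← lie_skew, he.lie13]
        simp
        abel
      · ext w
        simp [courantBracket, coadjoint]
    rw [this, he0]
    module
  have hm : neutralMetric k (e 1, (0 : Module.Dual ℝ g)) = 0 := by
    simp [neutralMetric, x1]
  obtain ⟨p, q, hpq⟩ := hK.courantBracket_map_of_eq hε.apply3 (he.lie_eq_zero hε)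
    (show ε (e 1, (0 : Module.Dual ℝ g)).1 = 0 from hε.apply1) hm hy1
  have hv3 : e.repr (K (e 1, 0)).1 3 = 0 := by
    rw [← hε.apply]
    exact hK.apply_fst_map hm
  have hβ0 : neutralMetric k (K (e 1, 0)) = 0 := by
    rw [hk, hK.neutralMetric_map_map, neutralMetric_inr_left]
    simp [hε.apply1]
  obtain ⟨⟨-, v1, v2⟩, ⟨b0, b1, b2⟩⟩ := he.eq_components hε hpq
  set Ky := K (e 1, 0) with hKy
  rw [← hk, h1] at v1
  rw [← hk, x1] at b1
  rw [← hk, x2] at b2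
  have hv2 : e.repr Ky.1 2 = 0 := by linarith
  have hB0 : Ky.2 (e 0) = 0 := by
    rw [neutralMetric, hk1, hk2] at hβ0
    simp only [map_smul, smul_eq_mul, LinearMap.smul_apply, hε.apply, hv3, mul_zero] at hβ0
    have : r * Ky.2 (e 0) = 0 := by linarith
    exact (mul_eq_zero.1 this).resolve_left h0
  have hB1 : Ky.2 (e 1) = 0 := by
    have : b * Ky.2 (e 1) = 0 := by linarith
    exact (mul_eq_zero.1 this).resolve_left hb
  have hB2 : Ky.2 (e 2) = 0 := by
    have : (b + c) * Ky.2 (e 2) = 0 := by linarith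
    exact (mul_eq_zero.1 this).resolve_left hbc
  have hfin : Ky = e.repr Ky.1 1 • (e 1, (0 : Module.Dual ℝ g))
      + (Ky.2 (e 3) - e.repr Ky.1 0 * (r⁻¹ * τ)) • ((0 : g), ε) + (e.repr Ky.1 0 * r⁻¹) • k := by
    have : Ky = e.repr Ky.1 1 • (e 1, (0 : Module.Dual ℝ g)) + Ky.2 (e 3) • ((0 : g), ε)
        + e.repr Ky.1 0 • (e 0, (0 : Module.Dual ℝ g)) := by
      refine Prod.ext ?_ ?_
      · conv_lhs => rw [eq_sum_four e Ky.1, hv2, hv3]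
        simp only [Prod.fst_add, Prod.smul_fst]
        module
      · simpa using dual Ky.2 hB0 hB1 hB2
    conv_lhs => rw [this, he0]
    module
  exact sq_eq_neg_one_of_map_eq hK hfin (e.coord 1) (by simp) (by simp [← hk, h1])

/-- The dual situation: modulo ε, `k` is a multiple of the third dual basis vector. The remaining
eigenvalues are `-a, -b, a, b`, and the line preserved by `K` is that of `e 0`. -/
theorem IsBidiagonal.false_of_snd (he : IsBidiagonal e a b c) (hε : IsLastCoord ε e)
    (hK : IsGeneralizedComplexStructure K) (ha : a ≠ 0) (hab : a + b ≠ 0)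
    (hk0 : (K ((0 : g), ε)).1 = 0)
    (x0 : (K ((0 : g), ε)).2 (e 0) = 0) (x1 : (K ((0 : g), ε)).2 (e 1) = 0)
    (x2 : (K ((0 : g), ε)).2 (e 2) ≠ 0) : False := by
  set k := K ((0 : g), ε) with hk
  have hy1 : courantBracket (e 3, (0 : Module.Dual ℝ g)) (e 0, (0 : Module.Dual ℝ g)) =
      (-a) • (e 0, (0 : Module.Dual ℝ g)) + (0 : ℝ) • ((0 : g), ε) + (0 : ℝ) • k := by
    refine Prod.ext ?_ ?_
    · simp only [courantBracket]
      rw [← lie_skew, he.lie03]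
      simp
    · ext w
      simp [courantBracket, coadjoint]
  have hm : neutralMetric k (e 0, (0 : Module.Dual ℝ g)) = 0 := by
    simp [neutralMetric, x0]
  obtain ⟨p, q, hpq⟩ := hK.courantBracket_map_of_eq hε.apply3 (he.lie_eq_zero hε)
    (show ε (e 0, (0 : Module.Dual ℝ g)).1 = 0 from hε.apply0) hm hy1
  have hv3 : e.repr (K (e 0, 0)).1 3 = 0 := by
    rw [← hε.apply]
    exact hK.apply_fst_map hm
  have hβ0 : neutralMetric k (K (e 0, 0)) = 0 := by
    rw [hk, hK.neutralMetric_map_map, neutralMetric_inr_left]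
    simp [hε.apply0]
  obtain ⟨⟨v0, -, -⟩, ⟨b0, b1, -⟩⟩ := he.eq_components hε hpq
  set Ky := K (e 0, 0) with hKy
  rw [← hk, x0] at b0
  rw [← hk, x1] at b1
  rw [← hk, hk0, LinearEquiv.map_zero, Finsupp.zero_apply] at v0
  have hv1 : e.repr Ky.1 1 = 0 := by linarith
  have hv2 : e.repr Ky.1 2 = 0 := by
    rw [neutralMetric, hk0, eq_sum_four e Ky.1, hv3, hv1] at hβ0
    simp [x0] at hβ0
    exact hβ0.resolve_right x2
  have hB0 : Ky.2 (e 0) = 0 := by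
    have : a * Ky.2 (e 0) = 0 := by linarith
    exact (mul_eq_zero.1 this).resolve_left ha
  have hB1 : Ky.2 (e 1) = 0 := by
    have : (a + b) * Ky.2 (e 1) = 0 := by linarith
    exact (mul_eq_zero.1 this).resolve_left hab
  have hfin : Ky = e.repr Ky.1 0 • (e 0, (0 : Module.Dual ℝ g))
      + (Ky.2 (e 3) - Ky.2 (e 2) / k.2 (e 2) * k.2 (e 3)) • ((0 : g), ε)
      + (Ky.2 (e 2) / k.2 (e 2)) • k := by
    refine Prod.ext ?_ ?_
    · conv_lhs => rw [eq_sum_four e Ky.1, hv1, hv2, hv3]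
      simp [hk0]
    · refine e.ext fun i => ?_
      fin_cases i
      · simp [hB0, hε.apply0, x0]
      · simp [hB1, hε.apply1, x1]
      · simp [hε.apply2, x2]
      · simp [hε.apply3]
  exact sq_eq_neg_one_of_map_eq hK hfin (e.coord 0) (by simp) (by simp [← hk, hk0])

/-- An algebra with a bidiagonal basis, no two of whose diagonal entries have sum zero, carries
no generalized complex structure. -/
theorem IsBidiagonal.not_isGeneralizedComplexStructure (he : IsBidiagonal e a b c)
    (hab : a + b ≠ 0) (hac : a + c ≠ 0) (hbc : b + c ≠ 0) :
    ¬ IsGeneralizedComplexStructure K := by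
  intro hK
  obtain ⟨ε, hε⟩ : ∃ ε : Module.Dual ℝ g, IsLastCoord ε e :=
    ⟨e.coord 3, by simp, by simp, by simp, by simp⟩
  obtain ⟨p, q, hpq⟩ := hK.courantBracket_map_inr hε.apply3 (he.apply_lie hε) (he.lie_eq_zero hε)
  -- `K` is an isometry and ε is isotropic, hence so is `K ε`.
  have hiso : (K ((0 : g), ε)).2 (K ((0 : g), ε)).1 = 0 := by
    have h := hK.neutralMetric_map_map ((0 : g), ε) ((0 : g), ε)
    simp only [neutralMetric, map_zero, add_zero, mul_zero] at h
    linarith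
  have hε3 : ε (K ((0 : g), ε)).1 = 0 := hK.apply_fst_map_inr
  set k := K ((0 : g), ε) with hk
  have fst_aux : ∀ (a b c : ℝ) (f : Module.Basis (Fin 4) ℝ g), IsBidiagonal f a b c →
      IsLastCoord ε f → f 3 = e 3 → a + b ≠ 0 → a + c ≠ 0 → b + c ≠ 0 → a + q = 0 → b ≠ 0 →
      k.1 ≠ 0 → False := by
    intro a b c f hf hεf hf3 hab hac hbc haq hb hne
    rw [← hf3] at hpq
    obtain ⟨⟨u0, u1, u2⟩, ⟨x0, x1, x2⟩⟩ := hf.eq_components hεf (μ := q) (p := p) (q := 0) (k := k)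
      (by rw [hpq]; module)
    rw [hεf.apply] at hε3
    have h1 : f.repr k.1 1 = 0 := by linear_combination -u0 - haq * f.repr k.1 0
    have h2 : f.repr k.1 2 = 0 := by
      rw [h1] at u1
      linarith
    have h0 : f.repr k.1 0 ≠ 0 := by
      intro h0
      apply hne
      rw [eq_sum_four f k.1, h0, h1, h2, hε3]
      simp
    have y0 : k.2 (f 0) = 0 := by
      rw [eq_sum_four f k.1, h1, h2, hε3] at hiso
      simpa [h0] using hiso
    have y1 : k.2 (f 1) = 0 := by
      refine (mul_eq_zero.1 ?_).resolve_left hab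
      linear_combination x1 - y0 + haq * k.2 (f 1)
    have y2 : k.2 (f 2) = 0 := by
      refine (mul_eq_zero.1 ?_).resolve_left hac
      linear_combination x2 - y1 + haq * k.2 (f 2)
    exact hf.false_of_fst hεf hK hb hbc h1 h2 h0 y0 y1 y2
  have fst_main : ∀ (a b c : ℝ) (f : Module.Basis (Fin 4) ℝ g), IsBidiagonal f a b c →
      IsLastCoord ε f → f 3 = e 3 → a + b ≠ 0 → a + c ≠ 0 → b + c ≠ 0 → a + q = 0 →
      k.1 ≠ 0 → False := by
    intro a b c f hf hεf hf3 hab hac hbc haq hne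
    -- At most one of `b` and `c` vanishes, their sum being nonzero; a nonzero one is put in second
    -- place.
    by_cases hb : b = 0
    · have hc : c ≠ 0 := by
        rintro rfl
        simp [hb] at hbc
      obtain ⟨f', hf', hεf', hf3'⟩ := hf.swap_right hεf
      exact fst_aux _ _ _ f' hf' hεf' (hf3'.trans hf3) hac hab (by rwa [add_comm]) haq hc hne
    · exact fst_aux _ _ _ f hf hεf hf3 hab hac hbc haq hb hne
  -- `K` has no real eigenvector, so `K ε` is not a multiple of ε.
  have hno : ∀ τ : ℝ, k ≠ τ • ((0 : g), ε) := by
    intro τ hτ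
    have h := congrArg (fun x => ε (e 3) * x.2 (e 3)) (congrArg K hτ)
    rw [map_smul, ← hk, hK.sq_eq_neg_one, hτ] at h
    simp [hε.apply3] at h
    nlinarith [sq_nonneg τ]
  have hno' : ∀ f : Module.Basis (Fin 4) ℝ g, IsLastCoord ε f → k.1 = 0 → k.2 (f 0) = 0 →
      k.2 (f 1) = 0 → k.2 (f 2) = 0 → False := by
    intro f hεf hk1 y0 y1 y2
    refine hno (k.2 (f 3)) (Prod.ext (by simpa using hk1) (f.ext fun i => ?_))
    fin_cases i <;> simp [y0, y1, y2, hεf.apply0, hεf.apply1, hεf.apply2, hεf.apply3]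
  have snd_aux : ∀ (a b c : ℝ) (f : Module.Basis (Fin 4) ℝ g), IsBidiagonal f a b c →
      IsLastCoord ε f → f 3 = e 3 → a + b ≠ 0 → c = q → a ≠ 0 → k.1 = 0 → False := by
    intro a b c f hf hεf hf3 hab hcq ha hk1
    rw [← hf3] at hpq
    obtain ⟨-, ⟨x0, x1, x2⟩⟩ := hf.eq_components hεf (μ := q) (p := p) (q := 0) (k := k)
      (by rw [hpq]; module)
    have y1 : k.2 (f 1) = 0 := by linear_combination x2 - hcq * k.2 (f 2)
    have y0 : k.2 (f 0) = 0 := by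
      rw [y1] at x1
      linarith
    exact hf.false_of_snd hεf hK ha hab hk1 y0 y1 fun y2 => hno' f hεf hk1 y0 y1 y2
  have snd_main : ∀ (a b c : ℝ) (f : Module.Basis (Fin 4) ℝ g), IsBidiagonal f a b c →
      IsLastCoord ε f → f 3 = e 3 → a + b ≠ 0 → c = q → k.1 = 0 → False := by
    intro a b c f hf hεf hf3 hab hcq hk1
    by_cases ha : a = 0
    · have hb : b ≠ 0 := by
        rintro rfl
        simp [ha] at hab
      obtain ⟨f', hf', hεf', hf3'⟩ := hf.swap_left hεf
      exact snd_aux _ _ _ f' hf' hεf' (hf3'.trans hf3) (by rwa [add_comm]) hcq hb hk1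
    · exact snd_aux _ _ _ f hf hεf hf3 hab hcq ha hk1
  obtain ⟨⟨u0, u1, u2⟩, ⟨x0, x1, x2⟩⟩ := he.eq_components hε (μ := q) (p := p) (q := 0) (k := k)
    (by rw [hpq]; module)
  -- `k` is an eigenvector for `q` modulo ε. If `k.1 ≠ 0`, then `-q` is one of `a, b, c`, which is
  -- moved to the first place. If `k.1 = 0`, then `q` itself is one of them, which is moved to the
  -- last place.
  by_cases hk1 : k.1 = 0
  · obtain ⟨f, hf, hεf, hf3⟩ := he.swap_right hε
    obtain ⟨f', hf', hεf', hf3'⟩ := hf.swap_left hεf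
    obtain ⟨f'', hf'', hεf'', hf3''⟩ := hf'.swap_right hεf'
    by_cases hcq : c = q
    · exact snd_main _ _ _ e he hε rfl hab hcq hk1
    by_cases hbq : b = q
    · exact snd_main _ _ _ f hf hεf hf3 hac hbq hk1
    by_cases haq : a = q
    · exact snd_main _ _ _ f'' hf'' hεf'' (hf3''.trans (hf3'.trans hf3)) (by rwa [add_comm])
        haq hk1
    have y0 : k.2 (e 0) = 0 := by
      refine (mul_eq_zero.1 ?_).resolve_left (sub_ne_zero.2 haq)
      linear_combination x0
    have y1 : k.2 (e 1) = 0 := by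
      refine (mul_eq_zero.1 ?_).resolve_left (sub_ne_zero.2 hbq)
      linear_combination x1 - y0
    have y2 : k.2 (e 2) = 0 := by
      refine (mul_eq_zero.1 ?_).resolve_left (sub_ne_zero.2 hcq)
      linear_combination x2 - y1
    exact hno' e hε hk1 y0 y1 y2
  · obtain ⟨f, hf, hεf, hf3⟩ := he.swap_left hε
    obtain ⟨f', hf', hεf', hf3'⟩ := he.swap_right hε
    obtain ⟨f'', hf'', hεf'', hf3''⟩ := hf'.swap_left hεf'
    by_cases haq : a + q = 0
    · exact fst_main _ _ _ e he hε rfl hab hac hbc haq hk1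
    by_cases hbq : b + q = 0
    · exact fst_main _ _ _ f hf hεf hf3 (by rwa [add_comm]) hbc hac hbq hk1
    by_cases hcq : c + q = 0
    · exact fst_main _ _ _ f'' hf'' hεf'' (hf3''.trans hf3') (by rwa [add_comm])
        (by rwa [add_comm]) hab hcq hk1
    have y2 : e.repr k.1 2 = 0 := by
      refine (mul_eq_zero.1 ?_).resolve_left hcq
      linear_combination -u2
    have y1 : e.repr k.1 1 = 0 := by
      refine (mul_eq_zero.1 ?_).resolve_left hbq
      linear_combination -u1 - y2
    have y0 : e.repr k.1 0 = 0 := by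
      refine (mul_eq_zero.1 ?_).resolve_left haq
      linear_combination -u0 - y1
    rw [hε.apply] at hε3
    apply hk1
    rw [eq_sum_four e k.1, y0, y1, y2, hε3]
    simp

end Bidiagonal

/-! ### Bidiagonal bases: scaling, construction, transport. -/

section Models

variable {g : Type*} [LieRing g] [LieAlgebra ℝ g]

variable (g) in
/-- `g` has a bidiagonal basis with diagonal entries `a, b, c`. -/
def HasBidiagonalBasis (a b c : ℝ) : Prop :=
  ∃ e : Module.Basis (Fin 4) ℝ g, IsBidiagonal e a b c

variable {a b c : ℝ}

theorem exists_isLastCoord (e : Module.Basis (Fin 4) ℝ g) :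
    ∃ ε : Module.Dual ℝ g, IsLastCoord ε e :=
  ⟨e.coord 3, by simp, by simp, by simp, by simp⟩

theorem HasBidiagonalBasis.swap_left (h : HasBidiagonalBasis g a b c) :
    HasBidiagonalBasis g b a c := by
  obtain ⟨e, he⟩ := h
  obtain ⟨ε, hε⟩ := exists_isLastCoord e
  obtain ⟨f, hf, -⟩ := he.swap_left hε
  exact ⟨f, hf⟩

theorem HasBidiagonalBasis.swap_right (h : HasBidiagonalBasis g a b c) :
    HasBidiagonalBasis g a c b := by
  obtain ⟨e, he⟩ := h
  obtain ⟨ε, hε⟩ := exists_isLastCoord e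
  obtain ⟨f, hf, -⟩ := he.swap_right hε
  exact ⟨f, hf⟩

/-- The diagonal only matters up to scale: `e 3` is multiplied by `t`, and rescaling `e 0` and `e 1`
restores the ones off the diagonal. -/
theorem HasBidiagonalBasis.smul (h : HasBidiagonalBasis g a b c) {t : ℝ} (ht : t ≠ 0) :
    HasBidiagonalBasis g (t * a) (t * b) (t * c) := by
  obtain ⟨e, he⟩ := h
  obtain ⟨f, h0, h1, h2, h3⟩ := exists_basis_of_linearIndependent_four e
    (t ^ 2 • e 0) (t • e 1) (e 2) (t • e 3) (fun c₀ c₁ c₂ c₃ h => by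
      obtain ⟨k0, k1, k2, k3⟩ := coeffs_eq_zero e (c₀ := c₀ * t ^ 2) (c₁ := c₁ * t) (c₂ := c₂)
        (c₃ := c₃ * t) (by rw [← h]; module)
      simpa [ht] using And.intro k0 (And.intro k1 (And.intro k2 k3)))
  refine ⟨f, ⟨?_, ?_, ?_, ?_, ?_, ?_⟩⟩ <;>
    simp only [h0, h1, h2, h3, lie_smul, smul_lie, he.lie01, he.lie02, he.lie12,
      he.lie03, he.lie13, he.lie23] <;>
    module

theorem HasBidiagonalBasis.of_diagonal (e : Module.Basis (Fin 4) ℝ g) (h01 : ⁅e 0, e 1⁆ = 0)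
    (h02 : ⁅e 0, e 2⁆ = 0) (h12 : ⁅e 1, e 2⁆ = 0) (h03 : ⁅e 0, e 3⁆ = a • e 0)
    (h13 : ⁅e 1, e 3⁆ = b • e 1) (h23 : ⁅e 2, e 3⁆ = c • e 2)
    (hab : a ≠ b) (hac : a ≠ c) (hbc : b ≠ c) : HasBidiagonalBasis g a b c := by
  rw [← sub_ne_zero] at hab hac hbc
  -- With `D` the action of `e 3`, `f 2 = e 0 + e 1 + e 2` is a cyclic vector because the
  -- eigenvalues are distinct; then `f 1 = (D - c) f 2` and `f 0 = (D - b) f 1`.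
  obtain ⟨f, h0, h1, h2, h3⟩ := exists_basis_of_linearIndependent_four e
    (((a - c) * (a - b)) • e 0) ((a - c) • e 0 + (b - c) • e 1) (e 0 + e 1 + e 2) (e 3)
    (fun c₀ c₁ c₂ c₃ h => by
      obtain ⟨k0, k1, k2, k3⟩ := coeffs_eq_zero e
        (c₀ := c₀ * ((a - c) * (a - b)) + c₁ * (a - c) + c₂) (c₁ := c₁ * (b - c) + c₂)
        (c₂ := c₂) (c₃ := c₃) (by rw [← h]; module)
      subst k2 k3
      have k1' : c₁ = 0 := by simpa [hbc] using k1
      subst k1'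
      simpa [hab, hac] using k0)
  refine ⟨f, ⟨?_, ?_, ?_, ?_, ?_, ?_⟩⟩ <;>
    simp only [h0, h1, h2, h3, lie_add, add_lie, lie_smul, smul_lie, h01, h02, h12, h03, h13, h23,
      lie_self, ← lie_skew (e 1) (e 0)] <;>
    module

theorem HasBidiagonalBasis.of_jordan (e : Module.Basis (Fin 4) ℝ g) (h01 : ⁅e 0, e 1⁆ = 0)
    (h02 : ⁅e 0, e 2⁆ = 0) (h12 : ⁅e 1, e 2⁆ = 0) (h03 : ⁅e 0, e 3⁆ = a • e 0)
    (h13 : ⁅e 1, e 3⁆ = e 0 + a • e 1) (h23 : ⁅e 2, e 3⁆ = b • e 2)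
    (hab : a ≠ b) : HasBidiagonalBasis g a a b := by
  rw [← sub_ne_zero] at hab
  -- Same recipe from the cyclic vector `f 2 = e 1 + e 2`: `f 1 = (D - b) f 2` and `f 0 = (D - a) f
  -- 1`.
  obtain ⟨f, h0, h1, h2, h3⟩ := exists_basis_of_linearIndependent_four e
    ((a - b) • e 0) (e 0 + (a - b) • e 1) (e 1 + e 2) (e 3)
    (fun c₀ c₁ c₂ c₃ h => by
      obtain ⟨k0, k1, k2, k3⟩ := coeffs_eq_zero e
        (c₀ := c₀ * (a - b) + c₁) (c₁ := c₁ * (a - b) + c₂)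
        (c₂ := c₂) (c₃ := c₃) (by rw [← h]; module)
      subst k2 k3
      have k1' : c₁ = 0 := by simpa [hab] using k1
      subst k1'
      simpa [hab] using k0)
  refine ⟨f, ⟨?_, ?_, ?_, ?_, ?_, ?_⟩⟩ <;>
    simp only [h0, h1, h2, h3, lie_add, add_lie, lie_smul, smul_lie, h01, h02, h12, h03, h13, h23,
      lie_self] <;>
    module

variable {g' : Type*} [LieRing g'] [LieAlgebra ℝ g']

theorem HasBidiagonalBasis.nonempty_lieEquiv (h : HasBidiagonalBasis g a b c)
    (h' : HasBidiagonalBasis g' a b c) : Nonempty (g ≃ₗ⁅ℝ⁆ g') := by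
  obtain ⟨e, he⟩ := h
  obtain ⟨f, hf⟩ := h'
  let Ψ : g ≃ₗ[ℝ] g' := e.equiv f (Equiv.refl _)
  have hΨ : ∀ i, Ψ (e i) = f i := fun i => by simp [Ψ]
  have hrepr : ∀ x i, f.repr (Ψ x) i = e.repr x i := by
    intro x i
    simp [Ψ, Module.Basis.equiv]
  refine ⟨{ Ψ with map_lie' := ?_ }⟩
  intro x y
  change Ψ ⁅x, y⁆ = ⁅Ψ x, Ψ y⁆
  rw [lie_eq_sum_four e x y, lie_eq_sum_four f (Ψ x) (Ψ y)]
  simp only [hrepr, he.lie01, he.lie02, he.lie12, he.lie03, he.lie13, he.lie23, hf.lie01, hf.lie02,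
    hf.lie12, hf.lie03, hf.lie13, hf.lie23, map_add, map_smul, hΨ, map_zero]

theorem HasBidiagonalBasis.of_lieEquiv (h : HasBidiagonalBasis g' a b c) (Ψ : g ≃ₗ⁅ℝ⁆ g') :
    HasBidiagonalBasis g a b c := by
  obtain ⟨e, he⟩ := h
  have hmap : ∀ x y : g', ⁅Ψ.symm x, Ψ.symm y⁆ = Ψ.symm ⁅x, y⁆ := fun x y =>
    (LieHom.map_lie Ψ.symm.toLieHom x y).symm
  have hadd : ∀ x y : g', Ψ.symm (x + y) = Ψ.symm x + Ψ.symm y := fun x y =>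
    map_add Ψ.symm.toLieHom x y
  have hsmul : ∀ (r : ℝ) (x : g'), Ψ.symm (r • x) = r • Ψ.symm x := fun r x =>
    map_smul Ψ.symm.toLieHom r x
  have hzero : Ψ.symm 0 = 0 := map_zero Ψ.symm.toLieHom
  have hb : ∀ i, e.map Ψ.toLinearEquiv.symm i = Ψ.symm (e i) := fun i => by
    rw [Module.Basis.map_apply]
    rfl
  refine ⟨e.map Ψ.toLinearEquiv.symm, ⟨?_, ?_, ?_, ?_, ?_, ?_⟩⟩ <;>
    simp only [hb, hmap, he.lie01, he.lie02, he.lie12, he.lie03, he.lie13, he.lie23, hadd, hsmul,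
      hzero]

end Models

/-! ### Explicit bases of the listed algebras. -/

namespace AlmostAbelian

theorem ext_three {D : Matrix (Fin 3) (Fin 3) ℝ} {x y : AlmostAbelian D}
    (h0 : x.left 0 = y.left 0) (h1 : x.left 1 = y.left 1) (h2 : x.left 2 = y.left 2)
    (h3 : x.right = y.right) : x = y := by
  refine AlmostAbelian.ext (funext fun i => ?_) h3
  fin_cases i <;> assumption

/-- The coordinates in the basis `f₁, f₂, f₃, f₄`. -/
noncomputable def equivFour (D : Matrix (Fin 3) (Fin 3) ℝ) : AlmostAbelian D ≃ₗ[ℝ] (Fin 4 → ℝ) :=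
    { toFun := fun x => ![x.left 0, x.left 1, x.left 2, x.right]
      invFun := fun v => ⟨![v 0, v 1, v 2], v 3⟩
      left_inv := fun x => ext_three rfl rfl rfl rfl
      right_inv := fun v => by
        ext i
        fin_cases i <;> rfl
      map_add' := fun x y => by
        ext i
        fin_cases i <;> rfl
      map_smul' := fun r x => by
        ext i
        fin_cases i <;> rfl }

theorem equivFour_symm_apply (D : Matrix (Fin 3) (Fin 3) ℝ) (v : Fin 4 → ℝ) :
    (equivFour D).symm v = ⟨![v 0, v 1, v 2], v 3⟩ := rfl

/-- The basis `f₁, f₂, f₃, f₄`. -/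
noncomputable def basisFour (D : Matrix (Fin 3) (Fin 3) ℝ) :
    Module.Basis (Fin 4) ℝ (AlmostAbelian D) :=
  Module.Basis.ofEquivFun (equivFour D)

theorem basisFour_eq (D : Matrix (Fin 3) (Fin 3) ℝ) :
    basisFour D 0 = ⟨![1, 0, 0], 0⟩ ∧ basisFour D 1 = ⟨![0, 1, 0], 0⟩ ∧
    basisFour D 2 = ⟨![0, 0, 1], 0⟩ ∧ basisFour D 3 = ⟨![0, 0, 0], 1⟩ := by
  refine ⟨?_, ?_, ?_, ?_⟩ <;>
  · rw [basisFour, Module.Basis.coe_ofEquivFun]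
    dsimp only
    rw [equivFour_symm_apply]
    refine ext_three ?_ ?_ ?_ ?_ <;> simp

/-- The coordinates in the basis `f₁, f₂, f₁', f₃`. -/
noncomputable def equivProd (D : Matrix (Fin 2) (Fin 2) ℝ) :
    (AlmostAbelian D × LieA1) ≃ₗ[ℝ] (Fin 4 → ℝ) :=
    { toFun := fun x => ![x.1.left 0, x.1.left 1, x.2.right, x.1.right]
      invFun := fun v => (⟨![v 0, v 1], v 3⟩, ⟨0, v 2⟩)
      left_inv := fun x => by
        refine Prod.ext (AlmostAbelian.ext (funext fun i => ?_) rfl)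
          (AlmostAbelian.ext (Subsingleton.elim _ _) rfl)
        fin_cases i <;> rfl
      right_inv := fun v => by
        ext i
        fin_cases i <;> rfl
      map_add' := fun x y => by
        ext i
        fin_cases i <;> rfl
      map_smul' := fun r x => by
        ext i
        fin_cases i <;> rfl }

theorem equivProd_symm_apply (D : Matrix (Fin 2) (Fin 2) ℝ) (v : Fin 4 → ℝ) :
    (equivProd D).symm v = (⟨![v 0, v 1], v 3⟩, ⟨0, v 2⟩) := rfl

/-- The basis `f₁, f₂, f₁', f₃` of the direct sum with the line spanned by `f₁'`. -/
noncomputable def basisProd (D : Matrix (Fin 2) (Fin 2) ℝ) :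
    Module.Basis (Fin 4) ℝ (AlmostAbelian D × LieA1) :=
  Module.Basis.ofEquivFun (equivProd D)

theorem ext_prod {D : Matrix (Fin 2) (Fin 2) ℝ} {x y : AlmostAbelian D × LieA1}
    (h0 : x.1.left 0 = y.1.left 0) (h1 : x.1.left 1 = y.1.left 1) (h2 : x.2.right = y.2.right)
    (h3 : x.1.right = y.1.right) : x = y := by
  refine Prod.ext (AlmostAbelian.ext (funext fun i => ?_) h3)
    (AlmostAbelian.ext (Subsingleton.elim _ _) h2)
  fin_cases i <;> assumption

theorem basisProd_eq (D : Matrix (Fin 2) (Fin 2) ℝ) :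
    basisProd D 0 = (⟨![1, 0], 0⟩, ⟨0, 0⟩) ∧ basisProd D 1 = (⟨![0, 1], 0⟩, ⟨0, 0⟩) ∧
    basisProd D 2 = (⟨![0, 0], 0⟩, ⟨0, 1⟩) ∧ basisProd D 3 = (⟨![0, 0], 1⟩, ⟨0, 0⟩) := by
  refine ⟨?_, ?_, ?_, ?_⟩ <;>
  · rw [basisProd, Module.Basis.coe_ofEquivFun]
    dsimp only
    rw [equivProd_symm_apply]
    refine ext_prod ?_ ?_ ?_ ?_ <;> simp

end AlmostAbelian

open AlmostAbelian

attribute [local simp] left_lie right_lie left_add right_add left_smul right_smul left_zero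
  right_zero

theorem hasBidiagonalBasis_lieA44 : HasBidiagonalBasis LieA44 1 1 1 := by
  obtain ⟨h0, h1, h2, h3⟩ := basisFour_eq !![1, 1, 0; 0, 1, 1; 0, 0, 1]
  refine ⟨basisFour _, ⟨?_, ?_, ?_, ?_, ?_, ?_⟩⟩ <;> simp only [h0, h1, h2, h3] <;>
    refine ext_three ?_ ?_ ?_ ?_ <;>
    simp

theorem hasBidiagonalBasis_lieA45 {α β : ℝ} (h1α : 1 ≠ α) (h1β : 1 ≠ β) (hαβ : α ≠ β) :
    HasBidiagonalBasis (LieA45 α β) 1 α β := by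
  obtain ⟨h0, h1, h2, h3⟩ := basisFour_eq !![1, 0, 0; 0, α, 0; 0, 0, β]
  refine .of_diagonal (basisFour _) ?_ ?_ ?_ ?_ ?_ ?_ h1α h1β hαβ <;>
    simp only [h0, h1, h2, h3] <;>
    refine ext_three ?_ ?_ ?_ ?_ <;>
    simp

theorem hasBidiagonalBasis_lieA42 {α : ℝ} (hα : 1 ≠ α) :
    HasBidiagonalBasis (LieA42 α) 1 1 α := by
  obtain ⟨h0, h1, h2, h3⟩ := basisFour_eq !![α, 0, 0; 0, 1, 1; 0, 0, 1]
  -- The Jordan block, on `f₂, f₃`, has to come before `f₁`.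
  let σ : Fin 4 ≃ Fin 4 := ⟨![2, 0, 1, 3], ![1, 2, 0, 3], by decide, by decide⟩
  have hσ : ∀ i, (basisFour !![α, 0, 0; 0, 1, 1; 0, 0, 1]).reindex σ i =
    basisFour !![α, 0, 0; 0, 1, 1; 0, 0, 1] (![1, 2, 0, 3] i) := fun i => by
      rw [Module.Basis.reindex_apply]; rfl
  refine .of_jordan ((basisFour _).reindex σ) ?_ ?_ ?_ ?_ ?_ ?_ hα <;>
    simp [hσ, h0, h1, h2, h3] <;>
    refine ext_three ?_ ?_ ?_ ?_ <;>
    simp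

theorem hasBidiagonalBasis_lieA32 : HasBidiagonalBasis (LieA32 × LieA1) 1 1 0 := by
  obtain ⟨h0, h1, h2, h3⟩ := basisProd_eq !![1, 1; 0, 1]
  refine .of_jordan (basisProd _) ?_ ?_ ?_ ?_ ?_ ?_ one_ne_zero <;> simp only [h0, h1, h2, h3] <;>
    refine ext_prod ?_ ?_ ?_ ?_ <;>
    simp

theorem hasBidiagonalBasis_lieA35 {α : ℝ} (h1α : 1 ≠ α) (hα : α ≠ 0) :
    HasBidiagonalBasis (LieA35 α × LieA1) 1 α 0 := by
  obtain ⟨h0, h1, h2, h3⟩ := basisProd_eq !![1, 0; 0, α]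
  refine .of_diagonal (basisProd _) ?_ ?_ ?_ ?_ ?_ ?_ h1α one_ne_zero hα <;>
    simp only [h0, h1, h2, h3] <;>
    refine ext_prod ?_ ?_ ?_ ?_ <;>
    simp

/-! ### The list in terms of bidiagonal bases. -/

section ListedAlgebras

variable (g : Type*) [LieRing g] [LieAlgebra ℝ g]

/-- `g` is isomorphic to an algebra of the list. -/
def IsListed : Prop :=
  Nonempty (g ≃ₗ⁅ℝ⁆ (LieA32 × LieA1)) ∨
    (∃ α : ℝ, 0 < |α| ∧ |α| < 1 ∧ Nonempty (g ≃ₗ⁅ℝ⁆ (LieA35 α × LieA1))) ∨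
    Nonempty (g ≃ₗ⁅ℝ⁆ LieA44) ∨
    (∃ α : ℝ, |α| ≠ 1 ∧ Nonempty (g ≃ₗ⁅ℝ⁆ LieA42 α)) ∨
    (∃ α β : ℝ, -1 < α ∧ α < β ∧ β < 1 ∧ α + β ≠ 0 ∧ Nonempty (g ≃ₗ⁅ℝ⁆ LieA45 α β))

variable {g} {a b c : ℝ}

theorem IsListed.exists_hasBidiagonalBasis (h : IsListed g) :
    ∃ a b c : ℝ, HasBidiagonalBasis g a b c ∧ a + b ≠ 0 ∧ a + c ≠ 0 ∧ b + c ≠ 0 := by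
  rcases h with ⟨⟨Ψ⟩⟩ | ⟨α, h0, h1, ⟨Ψ⟩⟩ | ⟨⟨Ψ⟩⟩ | ⟨α, h1, ⟨Ψ⟩⟩ | ⟨α, β, h1, h2, h3, h4, ⟨Ψ⟩⟩
  · exact ⟨1, 1, 0, hasBidiagonalBasis_lieA32.of_lieEquiv Ψ, by norm_num, by norm_num, by norm_num⟩
  · have hα : α ≠ 0 := abs_pos.1 h0
    rw [abs_lt] at h1
    exact ⟨1, α, 0, (hasBidiagonalBasis_lieA35 h1.2.ne' hα).of_lieEquiv Ψ, by linarith,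
      by norm_num, by simpa using hα⟩
  · exact ⟨1, 1, 1, hasBidiagonalBasis_lieA44.of_lieEquiv Ψ, by norm_num, by norm_num, by norm_num⟩
  · have h2 : 1 ≠ α := fun h => h1 (by rw [← h, abs_one])
    have h3 : 1 + α ≠ 0 := fun h => h1 (by rw [eq_neg_of_add_eq_zero_right h, abs_neg, abs_one])
    exact ⟨1, 1, α, (hasBidiagonalBasis_lieA42 h2).of_lieEquiv Ψ, by norm_num, h3, h3⟩
  · exact ⟨1, α, β, (hasBidiagonalBasis_lieA45 (by linarith) (by linarith)
      (by linarith)).of_lieEquiv Ψ, by linarith, by linarith, h4⟩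

/-- Scaling turns the repeated entry into 1. The value `c = 0` needs no separate treatment:
`A_{4,2}^0` is `A_{3,2} ⊕ A_1`. Likewise `A_{3,5}^α ⊕ A_1` is the case of a zero parameter in
`A_{4,5}`, so the first two families of the list are not needed in this direction. -/
theorem HasBidiagonalBasis.isListed_of_eq (h : HasBidiagonalBasis g a a c) (ha : a + a ≠ 0)
    (hac : a + c ≠ 0) : IsListed g := by
  have ha0 : a ≠ 0 := by
    rintro rfl
    simp at ha
  have h' := h.smul (inv_ne_zero ha0)
  rw [inv_mul_cancel₀ ha0] at h'
  by_cases hc : a = c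
  · subst hc
    rw [inv_mul_cancel₀ ha0] at h'
    exact Or.inr (Or.inr (Or.inl (h'.nonempty_lieEquiv hasBidiagonalBasis_lieA44)))
  · have h1 : a⁻¹ * c ≠ 1 := fun h => hc (by field_simp at h; exact h.symm)
    have h2 : a⁻¹ * c ≠ -1 := fun h => hac (by field_simp at h; linarith)
    refine Or.inr (Or.inr (Or.inr (Or.inl ⟨a⁻¹ * c, ?_,
      h'.nonempty_lieEquiv (hasBidiagonalBasis_lieA42 h1.symm)⟩)))
    intro h
    rcases (abs_eq zero_le_one).1 h with h | h
    exacts [h1 h, h2 h]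

theorem HasBidiagonalBasis.isListed_of_abs_lt (h : HasBidiagonalBasis g a b c) (hba : |b| < |a|)
    (hca : |c| < |a|) (hbc : b ≠ c) (hbc' : b + c ≠ 0) : IsListed g := by
  have ha : a ≠ 0 := abs_pos.1 ((abs_nonneg b).trans_lt hba)
  have h' := h.smul (inv_ne_zero ha)
  rw [inv_mul_cancel₀ ha] at h'
  have key : ∀ x : ℝ, |x| < |a| → -1 < a⁻¹ * x ∧ a⁻¹ * x < 1 := by
    intro x hx
    rw [← abs_lt, abs_mul, abs_inv, inv_mul_lt_iff₀ (abs_pos.2 ha), mul_one]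
    exact hx
  obtain ⟨hb1, hb2⟩ := key b hba
  obtain ⟨hc1, hc2⟩ := key c hca
  have hne : a⁻¹ * b ≠ a⁻¹ * c := fun h => hbc (mul_left_cancel₀ (inv_ne_zero ha) h)
  have hsum : a⁻¹ * b + a⁻¹ * c ≠ 0 := by
    rw [← mul_add]
    exact mul_ne_zero (inv_ne_zero ha) hbc'
  rcases hne.lt_or_gt with hlt | hlt
  · exact Or.inr (Or.inr (Or.inr (Or.inr ⟨_, _, hb1, hlt, hc2, hsum,
      h'.nonempty_lieEquiv (hasBidiagonalBasis_lieA45 hb2.ne' hc2.ne' hne)⟩)))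
  · exact Or.inr (Or.inr (Or.inr (Or.inr ⟨_, _, hc1, hlt, hb2, by rwa [add_comm],
      h'.swap_right.nonempty_lieEquiv (hasBidiagonalBasis_lieA45 hc2.ne' hb2.ne' hne.symm)⟩)))

theorem HasBidiagonalBasis.isListed (h : HasBidiagonalBasis g a b c) (hab : a + b ≠ 0)
    (hac : a + c ≠ 0) (hbc : b + c ≠ 0) : IsListed g := by
  by_cases eab : a = b
  · subst eab
    exact h.isListed_of_eq hab hac
  by_cases eac : a = c
  · subst eac
    exact h.swap_right.isListed_of_eq hac hab
  by_cases ebc : b = c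
  · subst ebc
    exact h.swap_left.swap_right.isListed_of_eq hbc (by rwa [add_comm])
  -- Distinct entries, no two opposite, have distinct absolute values. The largest one is moved to
  -- the front and scaled to 1.
  have key : ∀ x y : ℝ, x ≠ y → x + y ≠ 0 → |x| ≠ |y| := by
    intro x y h1 h2 h
    rcases abs_eq_abs.1 h with h | h
    exacts [h1 h, h2 (by linarith)]
  have kab := key a b eab hab
  have kac := key a c eac hac
  have kbc := key b c ebc hbc
  rcases kab.lt_or_gt with h1 | h1
  · rcases kbc.lt_or_gt with h2 | h2
    · exact h.swap_right.swap_left.isListed_of_abs_lt (h1.trans h2) h2 eab hab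
    · exact h.swap_left.isListed_of_abs_lt h1 h2 eac hac
  · rcases kac.lt_or_gt with h2 | h2
    · exact h.swap_right.swap_left.isListed_of_abs_lt h2 (h1.trans h2) eab hab
    · exact h.isListed_of_abs_lt h1 h2 ebc hbc

theorem IsListed.not_exists_isGeneralizedComplexStructure (h : IsListed g) :
    ¬ ∃ K : Module.End ℝ (g × Module.Dual ℝ g), IsGeneralizedComplexStructure K := by
  rintro ⟨K, hK⟩
  obtain ⟨a, b, c, ⟨e, he⟩, hab, hac, hbc⟩ := h.exists_hasBidiagonalBasis
  exact he.not_isGeneralizedComplexStructure hab hac hbc hK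

end ListedAlgebras

/-! ### Endomorphisms of `ℝ³`: cyclic vectors and complex planes. -/

section Endomorphism

open Polynomial in
/-- An endomorphism of `ℝ³` has a cyclic vector or is annihilated by a polynomial of degree at
most two. -/
theorem exists_cyclic_or_quadratic (D : Module.End ℝ (Fin 3 → ℝ)) :
    (∃ v, ∀ c₀ c₁ c₂ : ℝ, c₀ • v + c₁ • D v + c₂ • D (D v) = 0 → c₀ = 0 ∧ c₁ = 0 ∧ c₂ = 0) ∨
    ∃ c₀ c₁ c₂ : ℝ, ¬ (c₀ = 0 ∧ c₁ = 0 ∧ c₂ = 0) ∧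
      ∀ v, c₀ • v + c₁ • D v + c₂ • D (D v) = 0 := by
  -- View `ℝ³` as an `ℝ[X]`-module with `X` acting by `D`. Some vector has the same annihilator as
  -- the whole module, so a quadratic relation at this vector holds everywhere.
  obtain ⟨x, hx⟩ := Module.exists_ker_toSpanSingleton_eq_annihilator ℝ[X] (Module.AEval' D)
  obtain ⟨v, rfl⟩ := (Module.AEval'.of D).surjective x
  have hsmul : ∀ (w : Fin 3 → ℝ) (c₀ c₁ c₂ : ℝ),
      (C c₀ + C c₁ * X + C c₂ * X ^ 2 : ℝ[X]) • Module.AEval'.of D w =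
        Module.AEval'.of D (c₀ • w + c₁ • D w + c₂ • D (D w)) := by
    intro w c₀ c₁ c₂
    rw [add_smul, add_smul, mul_smul, mul_smul, Module.AEval'.X_smul_of, Module.AEval'.X_pow_smul_of]
    simp only [Module.AEval.C_smul, map_add, map_smul, pow_two]
    rfl
  by_cases h : ∀ c₀ c₁ c₂ : ℝ, c₀ • v + c₁ • D v + c₂ • D (D v) = 0 → c₀ = 0 ∧ c₁ = 0 ∧ c₂ = 0
  · exact Or.inl ⟨v, h⟩
  · push Not at h
    obtain ⟨c₀, c₁, c₂, hv, hc⟩ := h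
    refine Or.inr ⟨c₀, c₁, c₂, fun h => hc h.1 h.2.1 h.2.2, fun w => ?_⟩
    have hmem : (C c₀ + C c₁ * X + C c₂ * X ^ 2 : ℝ[X]) ∈
        LinearMap.ker (LinearMap.toSpanSingleton ℝ[X] _ (Module.AEval'.of D v)) := by
      rw [LinearMap.mem_ker, LinearMap.toSpanSingleton_apply, hsmul, hv, map_zero]
    rw [hx, Module.mem_annihilator] at hmem
    have h := hmem (Module.AEval'.of D w)
    rw [hsmul] at h
    exact (LinearEquiv.map_eq_zero_iff _).1 h

/-- A pair of vectors spans a plane on which `D` acts as multiplication by a complex number. -/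
def IsComplexPair (D : Module.End ℝ (Fin 3 → ℝ)) (v w : Fin 3 → ℝ) (p q : ℝ) : Prop :=
  LinearIndependent ℝ ![v, w] ∧ D v = p • v + q • w ∧ D w = p • w - q • v

variable {D : Module.End ℝ (Fin 3 → ℝ)}

/-- Completing the square, `D + β / 2` has square `-δ²` on `u`, so the second vector is `δ⁻¹ (D + β
/ 2) u`. Dependence of the two would give `D` a real eigenvalue on `u`. -/
theorem exists_isComplexPair_of_disc_neg {β γ : ℝ} (h : β ^ 2 - 4 * γ < 0) {u : Fin 3 → ℝ}
    (hu : u ≠ 0) (hD : D (D u) + β • D u + γ • u = 0) :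
    ∃ v w p q, IsComplexPair D v w p q := by
  have hδ : 0 < (4 * γ - β ^ 2) / 4 := by linarith
  set δ := √((4 * γ - β ^ 2) / 4) with hδdef
  have hδ0 : 0 < δ := Real.sqrt_pos.2 hδ
  have hsq : δ ^ 2 = (4 * γ - β ^ 2) / 4 := Real.sq_sqrt hδ.le
  have hDu : D (D u) = -(β • D u) - γ • u := by
    rw [← sub_eq_zero, ← hD]
    module
  have e1 : D u = (-β / 2) • u + δ • (δ⁻¹ • (D u + (β / 2) • u)) := by
    rw [smul_inv_smul₀ hδ0.ne']
    module
  have e2 : D (δ⁻¹ • (D u + (β / 2) • u)) =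
      (-β / 2) • (δ⁻¹ • (D u + (β / 2) • u)) - δ • u := by
    have h1 : δ • u = δ⁻¹ • ((4 * γ - β ^ 2) / 4) • u := by
      rw [smul_smul, ← hsq]
      congr 1
      field_simp
    rw [h1, map_smul, map_add, map_smul, hDu]
    module
  refine ⟨u, δ⁻¹ • (D u + (β / 2) • u), -β / 2, δ, ?_, e1, e2⟩
  generalize δ⁻¹ • (D u + (β / 2) • u) = w at e1 e2
  rw [LinearIndependent.pair_iff]
  intro s t hst
  by_cases ht : t = 0
  · subst ht
    simpa [hu] using hst
  exfalso
  have hw : w = (-(t⁻¹ * s)) • u := by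
    have : t⁻¹ • (s • u + t • w) = 0 := by rw [hst, smul_zero]
    rw [smul_add, inv_smul_smul₀ ht] at this
    rw [← sub_eq_zero, ← this]
    module
  rw [hw] at e2
  rw [map_smul, e1, hw] at e2
  have h3 : (δ * (1 + (t⁻¹ * s) ^ 2)) • u = 0 := by
    rw [← sub_eq_zero] at e2
    rw [← e2]
    module
  rcases smul_eq_zero.1 h3 with h3 | h3
  · have : 0 < δ * (1 + (t⁻¹ * s) ^ 2) := by positivity
    linarith
  · exact hu h3

/-- The complex number may be real: two independent eigenvectors for one eigenvalue form a pair with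
`q = 0`. -/
theorem exists_isComplexPair_of_finrank_ker {μ : ℝ}
    (h : 1 < Module.finrank ℝ (LinearMap.ker (D - algebraMap ℝ _ μ))) :
    ∃ v w p q, IsComplexPair D v w p q := by
  have hnt : Nontrivial (LinearMap.ker (D - algebraMap ℝ (Module.End ℝ (Fin 3 → ℝ)) μ)) :=
    Module.nontrivial_of_finrank_pos (zero_lt_one.trans h)
  obtain ⟨x, hx⟩ := exists_ne (0 : LinearMap.ker (D - algebraMap ℝ (Module.End ℝ (Fin 3 → ℝ)) μ))
  obtain ⟨y, hxy⟩ := exists_linearIndependent_pair_of_one_lt_finrank h hx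
  have heig : ∀ z : LinearMap.ker (D - algebraMap ℝ (Module.End ℝ (Fin 3 → ℝ)) μ),
      D (z : Fin 3 → ℝ) = μ • (z : Fin 3 → ℝ) := by
    intro z
    have := z.2
    rw [LinearMap.mem_ker, LinearMap.sub_apply, sub_eq_zero] at this
    simpa using this
  refine ⟨x, y, μ, 0, ?_, ?_, ?_⟩
  · rw [LinearIndependent.pair_iff] at hxy ⊢
    intro s t hst
    refine hxy s t (Subtype.ext ?_)
    simpa using hst
  · rw [heig]
    module
  · rw [heig]
    module

theorem exists_isComplexPair_of_quadratic {c₀ c₁ c₂ : ℝ} (hc : ¬ (c₀ = 0 ∧ c₁ = 0 ∧ c₂ = 0))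
    (h : ∀ v, c₀ • v + c₁ • D v + c₂ • D (D v) = 0) :
    ∃ v w p q, IsComplexPair D v w p q := by
  have hdim : Module.finrank ℝ (Fin 3 → ℝ) = 3 := by simp
  obtain ⟨u, hu⟩ := exists_ne (0 : Fin 3 → ℝ)
  by_cases h2 : c₂ = 0
  · subst h2
    have h1 : c₁ ≠ 0 := by
      rintro rfl
      have := h u
      simp [hu] at this
      exact hc ⟨this, rfl, rfl⟩
    refine exists_isComplexPair_of_finrank_ker (μ := -(c₁⁻¹ * c₀)) ?_
    have hker : LinearMap.ker (D - algebraMap ℝ (Module.End ℝ (Fin 3 → ℝ)) (-(c₁⁻¹ * c₀))) = ⊤ := by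
      rw [LinearMap.ker_eq_top]
      refine LinearMap.ext fun v => ?_
      have hv : c₁⁻¹ • (c₀ • v + c₁ • D v + (0 : ℝ) • D (D v)) = 0 := by rw [h v, smul_zero]
      rw [smul_add, smul_add, inv_smul_smul₀ h1] at hv
      rw [LinearMap.sub_apply, LinearMap.zero_apply, Module.algebraMap_end_apply, ← hv]
      module
    rw [hker, finrank_top, hdim]
    norm_num
  · have h' : ∀ v, D (D v) + (c₂⁻¹ * c₁) • D v + (c₂⁻¹ * c₀) • v = 0 := by
      intro v
      have hv : c₂⁻¹ • (c₀ • v + c₁ • D v + c₂ • D (D v)) = 0 := by rw [h v, smul_zero]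
      rw [smul_add, smul_add, inv_smul_smul₀ h2] at hv
      rw [← hv]
      module
    generalize c₂⁻¹ * c₁ = β at h'
    generalize c₂⁻¹ * c₀ = γ at h'
    by_cases hd : β ^ 2 - 4 * γ < 0
    · exact exists_isComplexPair_of_disc_neg hd hu (h' u)
    · push Not at hd
      set s := √(β ^ 2 - 4 * γ) with hs
      have hsq : s ^ 2 = β ^ 2 - 4 * γ := Real.sq_sqrt hd
      set A := D - algebraMap ℝ (Module.End ℝ (Fin 3 → ℝ)) ((-β - s) / 2) with hA
      set B := D - algebraMap ℝ (Module.End ℝ (Fin 3 → ℝ)) ((-β + s) / 2) with hB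
      -- As `A B = 0`, the kernels of `A` and `B` have dimensions of sum at least three, so one of
      -- them contains a plane.
      have hAB : LinearMap.range B ≤ LinearMap.ker A := by
        rintro _ ⟨v, rfl⟩
        rw [LinearMap.mem_ker]
        simp only [hA, hB, LinearMap.sub_apply, Module.algebraMap_end_apply, map_sub, map_smul]
        have hγ : γ = (β ^ 2 - s ^ 2) / 4 := by linarith
        rw [← h' v, hγ]
        module
      have h1 := Submodule.finrank_mono hAB
      have h2 := LinearMap.finrank_range_add_finrank_ker B
      rw [hdim] at h2
      by_cases hker : 1 < Module.finrank ℝ (LinearMap.ker B)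
      · exact exists_isComplexPair_of_finrank_ker hker
      · exact exists_isComplexPair_of_finrank_ker (μ := (-β - s) / 2) (by rw [← hA]; omega)

theorem exists_root_cubic (p q r : ℝ) : ∃ a : ℝ, a ^ 3 = p * a ^ 2 + q * a + r := by
  let f : ℝ → ℝ := fun x => x ^ 3 - (p * x ^ 2 + q * x + r)
  have hf : Continuous f := by fun_prop
  set M := 1 + |p| + |q| + |r| with hM
  have hp := abs_nonneg p
  have hq := abs_nonneg q
  have hr := abs_nonneg r
  have hM1 : 1 ≤ M := by linarith
  have hM2 : M ≤ M ^ 2 := by nlinarith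
  have hpos : 0 ≤ f M := by
    have h1 : p * M ^ 2 ≤ |p| * M ^ 2 := mul_le_mul_of_nonneg_right (le_abs_self p) (sq_nonneg M)
    have h2 : q * M ≤ |q| * M ^ 2 :=
      (mul_le_mul_of_nonneg_right (le_abs_self q) (by linarith)).trans
        (mul_le_mul_of_nonneg_left hM2 hq)
    have h3 : r ≤ |r| * M ^ 2 := (le_abs_self r).trans (le_mul_of_one_le_right hr (by linarith))
    have h4 : M ^ 3 = (1 + |p| + |q| + |r|) * M ^ 2 := by rw [← hM]; ring
    have h5 := sq_nonneg M
    simp only [f]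
    linarith
  have hneg : f (-M) ≤ 0 := by
    have h1 : -p * M ^ 2 ≤ |p| * M ^ 2 := mul_le_mul_of_nonneg_right (neg_le_abs p) (sq_nonneg M)
    have h2 : q * M ≤ |q| * M ^ 2 :=
      (mul_le_mul_of_nonneg_right (le_abs_self q) (by linarith)).trans
        (mul_le_mul_of_nonneg_left hM2 hq)
    have h3 : -r ≤ |r| * M ^ 2 := (neg_le_abs r).trans (le_mul_of_one_le_right hr (by linarith))
    have h4 : M ^ 3 = (1 + |p| + |q| + |r|) * M ^ 2 := by rw [← hM]; ring
    have h5 := sq_nonneg M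
    simp only [f]
    nlinarith
  obtain ⟨a, -, ha⟩ := intermediate_value_Icc (by linarith : -M ≤ M) hf.continuousOn
    (Set.mem_Icc.2 ⟨hneg, hpos⟩)
  exact ⟨a, sub_eq_zero.1 ha⟩

end Endomorphism

/-! ### Algebras with an abelian ideal of codimension one. -/

section AbelianIdeal

variable {g : Type*} [LieRing g] [LieAlgebra ℝ g]

variable (g) in
/-- `g` carries a generalized complex structure. -/
def HasGeneralizedComplexStructure : Prop :=
  ∃ K : Module.End ℝ (g × Module.Dual ℝ g), IsGeneralizedComplexStructure K

/-- The symplectic form is `e⁰³ + e¹²`. Its first term is always closed; the second is closed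
because `e 3` acts with trace `b + c = 0`, up to sign, on the ideal modulo `e 0`. -/
theorem HasBidiagonalBasis.hasGeneralizedComplexStructure {a b c : ℝ}
    (h : HasBidiagonalBasis g a b c) (hbc : b + c = 0) : HasGeneralizedComplexStructure g := by
  obtain ⟨e, he⟩ := h
  refine exists_isGeneralizedComplexStructure_of_symplectic_frame e 0 0 1 1 0 0 (by norm_num) ?_
  intro ω alt e01 e02 e03 e12 e13 e23 e10 e20 e30 e21 e31 e32
  simp only [he.lie01, he.lie02, he.lie12, he.lie03, he.lie13, he.lie23, map_zero, map_add,
    map_smul, LinearMap.zero_apply, LinearMap.add_apply, LinearMap.smul_apply, smul_eq_mul, alt,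
    e01, e02, e12, e10, e20, e21]
  refine ⟨?_, ?_, ?_, ?_⟩ <;> linarith

theorem HasBidiagonalBasis.hasGeneralizedComplexStructure_or_isListed {a b c : ℝ}
    (h : HasBidiagonalBasis g a b c) : HasGeneralizedComplexStructure g ∨ IsListed g := by
  by_cases hbc : b + c = 0
  · exact Or.inl (h.hasGeneralizedComplexStructure hbc)
  by_cases hac : a + c = 0
  · exact Or.inl (h.swap_left.hasGeneralizedComplexStructure hac)
  by_cases hab : a + b = 0
  · exact Or.inl (h.swap_right.swap_left.hasGeneralizedComplexStructure hab)
  exact Or.inr (h.isListed hab hac hbc)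

section Embedding

variable {e : Module.Basis (Fin 4) ℝ g} {ι : (Fin 3 → ℝ) →ₗ[ℝ] g} {D : Module.End ℝ (Fin 3 → ℝ)}

theorem exists_basis_of_embedding (hι : ∀ v, ι v = v 0 • e 0 + v 1 • e 1 + v 2 • e 2)
    {u v w : Fin 3 → ℝ} (h : ∀ c₀ c₁ c₂ : ℝ, c₀ • u + c₁ • v + c₂ • w = 0 →
      c₀ = 0 ∧ c₁ = 0 ∧ c₂ = 0) :
    ∃ b : Module.Basis (Fin 4) ℝ g, b 0 = ι u ∧ b 1 = ι v ∧ b 2 = ι w ∧ b 3 = e 3 := by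
  refine exists_basis_of_linearIndependent_four e _ _ _ _ fun c₀ c₁ c₂ c₃ hc => ?_
  have h1 : ι (c₀ • u + c₁ • v + c₂ • w) + c₃ • e 3 = 0 := by
    rw [← hc]
    simp only [map_add, map_smul]
  rw [hι] at h1
  obtain ⟨k0, k1, k2, k3⟩ := coeffs_eq_zero e h1
  have h2 : c₀ • u + c₁ • v + c₂ • w = 0 := by
    ext i
    fin_cases i <;> assumption
  obtain ⟨r0, r1, r2⟩ := h _ _ _ h2
  exact ⟨r0, r1, r2, k3⟩

theorem hasGeneralizedComplexStructure_of_isComplexPair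
    (hι : ∀ v, ι v = v 0 • e 0 + v 1 • e 1 + v 2 • e 2) (hab : ∀ v w, ⁅ι v, ι w⁆ = 0)
    (hD : ∀ v, ⁅ι v, e 3⁆ = ι (D v)) {v w : Fin 3 → ℝ} {p q : ℝ} (h : IsComplexPair D v w p q) :
    HasGeneralizedComplexStructure g := by
  obtain ⟨hli, hv, hw⟩ := h
  obtain ⟨u, hu⟩ := exists_linearIndependent_cons_of_lt_finrank hli (by simp)
  rw [Fintype.linearIndependent_iff] at hu
  obtain ⟨b, b0, b1, b2, b3⟩ := exists_basis_of_embedding (e := e) hι (u := v) (v := w) (w := u)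
    (fun c₀ c₁ c₂ hc => by
      have h := hu ![c₂, c₀, c₁] (by
        rw [← hc]
        simp [Fin.sum_univ_succ]
        abel)
      exact ⟨h 1, h 2, h 0⟩)
  -- The complex structure sends `ι v` to `ι w`, and the completing vector `ι u` of the ideal to `e
  -- 3`.
  refine exists_isGeneralizedComplexStructure_of_complex_frame b q (-p) 0 0 ?_ ?_
  · rw [b0, b1, b2, b3, hab, hD, hw, map_sub, map_smul, map_smul]
    module
  · rw [b0, b1, b2, b3, hab, hD, hv, map_add, map_smul, map_smul]
    module

theorem hasGeneralizedComplexStructure_or_isListed_of_embedding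
    (hι : ∀ v, ι v = v 0 • e 0 + v 1 • e 1 + v 2 • e 2) (hab : ∀ v w, ⁅ι v, ι w⁆ = 0)
    (hD : ∀ v, ⁅ι v, e 3⁆ = ι (D v)) : HasGeneralizedComplexStructure g ∨ IsListed g := by
  rcases exists_cyclic_or_quadratic D with ⟨v, hv⟩ | ⟨c₀, c₁, c₂, hc, h⟩
  · obtain ⟨p, q, r, hpqr⟩ : ∃ p q r : ℝ, D (D (D v)) = p • D (D v) + q • D v + r • v := by
      have hli : LinearIndependent ℝ ![v, D v, D (D v)] := by
        rw [Fintype.linearIndependent_iff]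
        intro c hc i
        obtain ⟨h0, h1, h2⟩ := hv (c 0) (c 1) (c 2) (by
          rw [← hc]
          simp [Fin.sum_univ_succ]
          abel)
        fin_cases i <;> assumption
      let b := basisOfLinearIndependentOfCardEqFinrank hli (by simp)
      have hb : ⇑b = ![v, D v, D (D v)] := coe_basisOfLinearIndependentOfCardEqFinrank _ _
      refine ⟨b.repr (D (D (D v))) 2, b.repr (D (D (D v))) 1, b.repr (D (D (D v))) 0, ?_⟩
      conv_lhs => rw [← b.sum_repr (D (D (D v)))]
      rw [hb]
      simp only [Fin.sum_univ_three, Matrix.cons_val]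
      abel
    -- The characteristic polynomial of `D` factors as `(X - a) (X² + β X + γ)`, so the quadratic
    -- factor annihilates `(D - a) v`.
    obtain ⟨a, ha⟩ := exists_root_cubic p q r
    have hr : r = a * (a ^ 2 - p * a - q) := by linear_combination -ha
    set β := a - p with hβ
    set γ := a * β - q with hγ
    have hDu : D (D (D v - a • v)) + β • D (D v - a • v) + γ • (D v - a • v) = 0 := by
      simp only [map_sub, map_smul, hpqr, hr, hγ, hβ]
      module
    by_cases hd : β ^ 2 - 4 * γ < 0
    · have hu : D v - a • v ≠ 0 := by
        intro h0
        have := hv (-a) 1 0 (by rw [← h0]; module)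
        exact one_ne_zero this.2.1
      obtain ⟨x, y, s, t, hxy⟩ := exists_isComplexPair_of_disc_neg hd hu hDu
      exact Or.inl (hasGeneralizedComplexStructure_of_isComplexPair hι hab hD hxy)
    · push Not at hd
      set s := √(β ^ 2 - 4 * γ) with hs
      have hsq : s ^ 2 = β ^ 2 - 4 * γ := Real.sq_sqrt hd
      have hγ' : γ = (β ^ 2 - s ^ 2) / 4 := by linarith
      rw [hγ'] at hDu
      clear_value s
      set b := (-β - s) / 2 with hb
      set c := (-β + s) / 2 with hc
      -- From the cyclic vector `v`: `f 1 = (D - c) v` and `f 0 = (D - b) (D - c) v`, which `D - a`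
      -- kills.
      obtain ⟨f, f0, f1, f2, f3⟩ := exists_basis_of_embedding (e := e) hι
        (u := D (D v) - (b + c) • D v + (b * c) • v) (v := D v - c • v) (w := v)
        (fun c₀ c₁ c₂ hc => by
          obtain ⟨h0, h1, h2⟩ := hv (c₀ * (b * c) - c₁ * c + c₂) (c₁ - c₀ * (b + c)) c₀
            (by rw [← hc]; module)
          subst h2
          simp at h1
          subst h1
          simpa using h0)
      refine HasBidiagonalBasis.hasGeneralizedComplexStructure_or_isListed (a := a) (b := b)
        (c := c) ⟨f, ⟨?_, ?_, ?_, ?_, ?_, ?_⟩⟩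
      · rw [f0, f1, hab]
      · rw [f0, f2, hab]
      · rw [f1, f2, hab]
      · rw [f0, f3, hD, ← map_smul ι]
        congr 1
        rw [← sub_eq_zero, ← hDu]
        simp only [map_sub, map_add, map_smul, hb, hc]
        module
      · rw [f0, f1, f3, hD, ← map_smul ι, ← map_add ι]
        congr 1
        simp only [map_sub, map_smul]
        module
      · rw [f1, f2, f3, hD, ← map_smul ι, ← map_add ι]
        congr 1
        module
  · obtain ⟨v, w, p, q, hvw⟩ := exists_isComplexPair_of_quadratic hc h
    exact Or.inl (hasGeneralizedComplexStructure_of_isComplexPair hι hab hD hvw)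

end Embedding

/-- The case of an abelian ideal of codimension one. -/
theorem hasGeneralizedComplexStructure_or_isListed_of_abelian_ideal (e : Module.Basis (Fin 4) ℝ g)
    (M : Fin 3 → Fin 3 → ℝ) (h01 : ⁅e 0, e 1⁆ = 0) (h02 : ⁅e 0, e 2⁆ = 0) (h12 : ⁅e 1, e 2⁆ = 0)
    (h03 : ⁅e 0, e 3⁆ = M 0 0 • e 0 + M 1 0 • e 1 + M 2 0 • e 2)
    (h13 : ⁅e 1, e 3⁆ = M 0 1 • e 0 + M 1 1 • e 1 + M 2 1 • e 2)
    (h23 : ⁅e 2, e 3⁆ = M 0 2 • e 0 + M 1 2 • e 1 + M 2 2 • e 2) :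
    HasGeneralizedComplexStructure g ∨ IsListed g := by
  let ι : (Fin 3 → ℝ) →ₗ[ℝ] g :=
    { toFun := fun v => v 0 • e 0 + v 1 • e 1 + v 2 • e 2
      map_add' := fun v w => by
        simp only [Pi.add_apply]
        module
      map_smul' := fun c v => by
        simp only [Pi.smul_apply, smul_eq_mul, RingHom.id_apply]
        module }
  have hι : ∀ v, ι v = v 0 • e 0 + v 1 • e 1 + v 2 • e 2 := fun _ => rfl
  refine hasGeneralizedComplexStructure_or_isListed_of_embedding (e := e) (ι := ι)
    (D := Matrix.toLin' (Matrix.of M)) hι ?_ ?_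
  · intro v w
    simp only [hι, add_lie, lie_add, smul_lie, lie_smul, h01, h02, h12, lie_self,
      ← lie_skew (e 1) (e 0), ← lie_skew (e 2) (e 0), ← lie_skew (e 2) (e 1)]
    simp
  · intro v
    simp only [hι, add_lie, smul_lie, h03, h13, h23, Matrix.toLin'_apply, Matrix.mulVec,
      dotProduct, Matrix.of_apply, Fin.sum_univ_three]
    module

end AbelianIdeal

/-! ### Algebras with a unimodular ideal of dimension three. -/

section UnimodularIdeal

variable {g : Type*} [LieRing g] [LieAlgebra ℝ g]

/-- `b 0, b 1, b 2` span an ideal with diagonal structure constants `s₀, s₁, s₂`, on which `b 3` acts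
by the matrix `D`. -/
structure IsMilnorBasis (b : Module.Basis (Fin 4) ℝ g) (s₀ s₁ s₂ : ℝ) (D : Fin 3 → Fin 3 → ℝ) :
    Prop where
  lie12 : ⁅b 1, b 2⁆ = s₀ • b 0
  lie02 : ⁅b 0, b 2⁆ = (-s₁) • b 1
  lie01 : ⁅b 0, b 1⁆ = s₂ • b 2
  lie03 : ⁅b 0, b 3⁆ = (-D 0 0) • b 0 + (-D 1 0) • b 1 + (-D 2 0) • b 2
  lie13 : ⁅b 1, b 3⁆ = (-D 0 1) • b 0 + (-D 1 1) • b 1 + (-D 2 1) • b 2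
  lie23 : ⁅b 2, b 3⁆ = (-D 0 2) • b 0 + (-D 1 2) • b 1 + (-D 2 2) • b 2

variable {b : Module.Basis (Fin 4) ℝ g} {s₀ s₁ s₂ : ℝ} {D : Fin 3 → Fin 3 → ℝ}

theorem IsMilnorBasis.rotate (h : IsMilnorBasis b s₀ s₁ s₂ D) :
    ∃ b' : Module.Basis (Fin 4) ℝ g,
      IsMilnorBasis b' s₁ s₂ s₀ (fun i j => D (![1, 2, 0] i) (![1, 2, 0] j)) := by
  obtain ⟨f, f0, f1, f2, f3⟩ := exists_basis_of_linearIndependent_four b (b 1) (b 2) (b 0) (b 3)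
    (fun c₀ c₁ c₂ c₃ hc => by
      obtain ⟨h0, h1, h2, h3⟩ := coeffs_eq_zero b (c₀ := c₂) (c₁ := c₀) (c₂ := c₁) (c₃ := c₃)
        (by rw [← hc]; module)
      exact ⟨h1, h2, h0, h3⟩)
  refine ⟨f, ⟨?_, ?_, ?_, ?_, ?_, ?_⟩⟩ <;> simp only [f0, f1, f2, f3, Matrix.cons_val]
  · rw [← lie_skew, h.lie02]
    module
  · rw [← lie_skew, h.lie01]
    module
  · rw [h.lie12]
  · rw [h.lie13]
    module
  · rw [h.lie23]
    module
  · rw [h.lie03]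
    module

/-- This is the derivation property of `ad (b 3)` on `⁅b 1, b 2⁆`; the other two pairs follow by
rotating the basis. -/
theorem IsMilnorBasis.jacobi (h : IsMilnorBasis b s₀ s₁ s₂ D) :
    s₀ * D 0 0 = s₀ * (D 1 1 + D 2 2) ∧ s₀ * D 1 0 = -(s₁ * D 0 1) ∧
      s₀ * D 2 0 = -(s₂ * D 0 2) := by
  have hj := leibniz_lie (b 3) (b 1) (b 2)
  rw [h.lie12, lie_smul, ← lie_skew (b 3) (b 0), ← lie_skew (b 3) (b 1), ← lie_skew (b 3) (b 2),
    h.lie03, h.lie13, h.lie23] at hj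
  simp only [neg_lie, lie_neg, add_lie, lie_add, smul_lie, lie_smul, lie_self,
    ← lie_skew (b 1) (b 0), h.lie12, h.lie02, h.lie01] at hj
  obtain ⟨h0, h1, h2, -⟩ := coeffs_eq b
    (c₀ := s₀ * D 0 0) (c₁ := s₀ * D 1 0) (c₂ := s₀ * D 2 0) (c₃ := 0)
    (d₀ := s₀ * (D 1 1 + D 2 2)) (d₁ := -(s₁ * D 0 1)) (d₂ := -(s₂ * D 0 2)) (d₃ := 0)
    (by linear_combination (norm := module) hj)
  exact ⟨h0, h1, h2⟩

theorem IsMilnorBasis.jacobi' (h : IsMilnorBasis b s₀ s₁ s₂ D) :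
    s₁ * D 1 1 = s₁ * (D 2 2 + D 0 0) ∧ s₁ * D 2 1 = -(s₂ * D 1 2) ∧
      s₁ * D 0 1 = -(s₀ * D 1 0) := by
  obtain ⟨b', h'⟩ := h.rotate
  exact h'.jacobi

theorem IsMilnorBasis.jacobi'' (h : IsMilnorBasis b s₀ s₁ s₂ D) :
    s₂ * D 2 2 = s₂ * (D 0 0 + D 1 1) ∧ s₂ * D 0 2 = -(s₀ * D 2 0) ∧
      s₂ * D 1 2 = -(s₁ * D 2 1) := by
  obtain ⟨b', h'⟩ := h.rotate
  exact h'.jacobi'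

/-- The reductive case. -/
theorem IsMilnorBasis.hasGeneralizedComplexStructure_of_mul_pos (h : IsMilnorBasis b s₀ s₁ s₂ D)
    (h01 : 0 < s₀ * s₁) (h2 : s₂ ≠ 0) : HasGeneralizedComplexStructure g := by
  obtain ⟨j00, j10, j20⟩ := h.jacobi
  obtain ⟨j11, j21, -⟩ := h.jacobi'
  obtain ⟨j22, -, -⟩ := h.jacobi''
  have h0 : s₀ ≠ 0 := by rintro rfl; simp at h01
  have h1 : s₁ ≠ 0 := by rintro rfl; simp at h01
  replace j00 := mul_left_cancel₀ h0 j00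
  replace j11 := mul_left_cancel₀ h1 j11
  replace j22 := mul_left_cancel₀ h2 j22
  have d00 : D 0 0 = 0 := by linarith
  have d11 : D 1 1 = 0 := by linarith
  have d22 : D 2 2 = 0 := by linarith
  have hpos : 0 < s₁ / s₀ := by
    have : s₁ / s₀ = s₀ * s₁ / s₀ ^ 2 := by field_simp
    rw [this]
    positivity
  set t := √(s₁ / s₀) with ht
  have ht0 : 0 < t := Real.sqrt_pos.2 hpos
  have hsq : t ^ 2 = s₁ / s₀ := Real.sq_sqrt hpos.le
  have hts : s₁ = t ^ 2 * s₀ := by rw [hsq]; field_simp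
  obtain ⟨r, hr⟩ : ∃ r, D 1 0 = r * s₁ := ⟨D 1 0 / s₁, by field_simp⟩
  obtain ⟨q, hq⟩ : ∃ q, D 2 0 = -(q * s₂) := ⟨-(D 2 0 / s₂), by field_simp⟩
  obtain ⟨p, hp⟩ : ∃ p, D 2 1 = p * s₂ := ⟨D 2 1 / s₂, by field_simp⟩
  have d01 : D 0 1 = -(r * s₀) := by
    apply mul_left_cancel₀ h1
    rw [hr] at j10
    linear_combination j10
  have d02 : D 0 2 = q * s₀ := by
    apply mul_left_cancel₀ h2
    rw [hq] at j20
    linear_combination j20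
  have d12 : D 1 2 = -(p * s₁) := by
    apply mul_left_cancel₀ h2
    rw [hp] at j21
    linear_combination j21
  -- The ideal is simple and `ad (b 3)` is inner on it: `f 3` is `b 3` minus the element inducing
  -- it, hence central. The complex structure sends `b 0` to `t • b 1` and `b 2` to `f 3`; with this
  -- `t`, `ad (b 2)` is a multiple of a rotation on the first pair.
  obtain ⟨f, f0, f1, f2, f3⟩ := exists_basis_of_linearIndependent_four b (b 0) (t • b 1) (b 2)
    (b 3 - p • b 0 - q • b 1 - r • b 2)
    (fun c₀ c₁ c₂ c₃ hc => by
      obtain ⟨k0, k1, k2, k3⟩ := coeffs_eq_zero b (c₀ := c₀ - c₃ * p) (c₁ := c₁ * t - c₃ * q)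
        (c₂ := c₂ - c₃ * r) (c₃ := c₃) (by rw [← hc]; module)
      subst k3
      simpa [ht0.ne'] using And.intro k0 (And.intro k1 k2))
  refine exists_isGeneralizedComplexStructure_of_complex_frame f 0 (-(t * s₀)) 0 0 ?_ ?_ <;>
    simp only [f0, f1, f2, f3, lie_sub, lie_smul, smul_lie, lie_self, h.lie12, h.lie02, h.lie01,
      h.lie03, h.lie13, ← lie_skew (b 1) (b 0), d00, d11, d01, hr, hq, hp, hts] <;>
    module

/-- Two of three nonzero reals have the same sign; a rotation brings them to the first two places.
-/
theorem IsMilnorBasis.hasGeneralizedComplexStructure_of_ne_zero (h : IsMilnorBasis b s₀ s₁ s₂ D)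
    (h0 : s₀ ≠ 0) (h1 : s₁ ≠ 0) (h2 : s₂ ≠ 0) : HasGeneralizedComplexStructure g := by
  obtain ⟨b', h'⟩ := h.rotate
  obtain ⟨b'', h''⟩ := h'.rotate
  by_cases h01 : 0 < s₀ * s₁
  · exact h.hasGeneralizedComplexStructure_of_mul_pos h01 h2
  by_cases h12 : 0 < s₁ * s₂
  · exact h'.hasGeneralizedComplexStructure_of_mul_pos h12 h0
  by_cases h20 : 0 < s₂ * s₀
  · exact h''.hasGeneralizedComplexStructure_of_mul_pos h20 h1
  exfalso
  have k01 : s₀ * s₁ < 0 := lt_of_le_of_ne (not_lt.1 h01) (mul_ne_zero h0 h1)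
  have k12 : s₁ * s₂ < 0 := lt_of_le_of_ne (not_lt.1 h12) (mul_ne_zero h1 h2)
  have k20 : s₂ * s₀ < 0 := lt_of_le_of_ne (not_lt.1 h20) (mul_ne_zero h2 h0)
  nlinarith [mul_pos_of_neg_of_neg k01 k12, sq_nonneg s₁, mul_pos (mul_pos_of_neg_of_neg k01 k12)
    (neg_pos.2 k20), sq_nonneg (s₀ * s₁ * s₂)]

/-- The case where the derived algebra of the ideal is two-dimensional. -/
theorem IsMilnorBasis.hasGeneralizedComplexStructure_of_rank_two
    (h : IsMilnorBasis b s₀ s₁ 0 D) (h0 : s₀ ≠ 0) (h1 : s₁ ≠ 0) :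
    HasGeneralizedComplexStructure g := by
  obtain ⟨j00, j10, j20⟩ := h.jacobi
  obtain ⟨j11, j21, -⟩ := h.jacobi'
  replace j00 := mul_left_cancel₀ h0 j00
  replace j11 := mul_left_cancel₀ h1 j11
  have d22 : D 2 2 = 0 := by linarith
  have d11 : D 1 1 = D 0 0 := by linarith
  have d20 : D 2 0 = 0 := by simpa [h0] using j20
  have d21 : D 2 1 = 0 := by simpa [h1] using j21
  by_cases ht : D 0 0 = 0
  · rw [ht] at d11
    -- Here `b 3` minus an element of the ideal is central. The form is `e⁰¹ + e²³` for the basis in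
    -- which this central vector replaces `b 3`.
    refine exists_isGeneralizedComplexStructure_of_symplectic_frame b 1 0 (D 0 2 / s₀) 0
      (D 1 2 / s₁) 1 (by norm_num) ?_
    intro ω alt e01 e02 e03 e12 e13 e23 e10 e20 e30 e21 e31 e32
    simp only [h.lie01, h.lie02, h.lie12, h.lie03, h.lie13, h.lie23, map_add, map_smul,
      LinearMap.add_apply, LinearMap.smul_apply, smul_eq_mul, alt,
      e01, e02, e03, e12, e13, e23, e10, e20, e21, d22, d11, d20, d21, ht]
    refine ⟨?_, ?_, ?_, ?_⟩ <;> field_simp <;> ring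
  -- The exact form `(x, y) ↦ e⁰ ⁅x, y⁆`, with Pfaffian `-s₀ D 0 0`.
  · refine exists_isGeneralizedComplexStructure_of_symplectic_frame b 0 0 (-D 0 0) s₀
      (-D 0 1) (-D 0 2) (by simp [ht, h0]) ?_
    intro ω alt e01 e02 e03 e12 e13 e23 e10 e20 e30 e21 e31 e32
    simp only [h.lie01, h.lie02, h.lie12, h.lie03, h.lie13, h.lie23, map_add, map_smul,
      LinearMap.add_apply, LinearMap.smul_apply, smul_eq_mul, alt,
      e01, e02, e03, e12, e13, e23, e10, e20, e21, d22, d11, d20, d21]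
    refine ⟨?_, ?_, ?_, ?_⟩ <;> linarith

/-- The matrix `A = (a b; c -a)` satisfies `A² = l²`, so nonzero columns of `A + l` and `A - l` are
eigenvectors for `l` and `-l`. -/
theorem exists_eigenvectors_of_trace_eq_zero {a b c l : ℝ} (hl : l ≠ 0) (h : l ^ 2 = a ^ 2 + b * c) :
    ∃ p q p' q' : ℝ, a * p + b * q = l * p ∧ c * p - a * q = l * q ∧ a * p' + b * q' = -l * p' ∧
      c * p' - a * q' = -l * q' ∧ p * q' - q * p' ≠ 0 := by
  by_cases hc : c = 0
  · by_cases hb : b = 0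
    · subst hb hc
      have : (l - a) * (l + a) = 0 := by linear_combination h
      rcases mul_eq_zero.1 this with h | h
      · exact ⟨1, 0, 0, 1, by linarith, by linarith, by linarith, by linarith, by norm_num⟩
      · exact ⟨0, 1, 1, 0, by linarith, by linarith, by linarith, by linarith, by norm_num⟩
    · refine ⟨b, l - a, b, -l - a, by ring, by linear_combination -h, by ring,
        by linear_combination -h, ?_⟩
      have : b * (-l - a) - (l - a) * b = -(2 * (l * b)) := by ring
      rw [this]
      simp [hl, hb]
  · refine ⟨a + l, c, a - l, c, by linear_combination -h, by ring, by linear_combination -h,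
      by ring, ?_⟩
    have : (a + l) * c - c * (a - l) = 2 * (l * c) := by ring
    rw [this]
    simp [hl, hc]

/-- The case of a Heisenberg ideal. -/
theorem IsMilnorBasis.hasGeneralizedComplexStructure_of_rank_one
    (h : IsMilnorBasis b 0 0 s₂ D) (h2 : s₂ ≠ 0) : HasGeneralizedComplexStructure g := by
  obtain ⟨j22, j02, j12⟩ := h.jacobi''
  replace j22 := mul_left_cancel₀ h2 j22
  have d02 : D 0 2 = 0 := by simpa [h2] using j02
  have d12 : D 1 2 = 0 := by simpa [h2] using j12
  by_cases ht : D 2 2 = 0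
  swap
  -- The exact form `(x, y) ↦ e² ⁅x, y⁆`, with Pfaffian `-s₂ D 2 2`.
  · refine exists_isGeneralizedComplexStructure_of_symplectic_frame b s₂ 0 (-D 2 0) 0
      (-D 2 1) (-D 2 2) (by simp [ht, h2]) ?_
    intro ω alt e01 e02 e03 e12 e13 e23 e10 e20 e30 e21 e31 e32
    simp only [h.lie01, h.lie02, h.lie12, h.lie03, h.lie13, h.lie23, map_add, map_smul,
      LinearMap.add_apply, LinearMap.smul_apply, smul_eq_mul, alt,
      e01, e02, e03, e12, e13, e23, e10, e20, e21, d02, d12, j22]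
    refine ⟨?_, ?_, ?_, ?_⟩ <;> ring
  have d11 : D 1 1 = -D 0 0 := by linarith
  -- `p` and `q` are such that `b 3 + p • b 0 + q • b 1` acts on `b 0, b 1` without component along
  -- the center `b 2`. What remains is a trace-free block on `b 0, b 1`, whose square is the scalar
  -- `D 0 0 ^ 2 + D 0 1 * D 1 0`.
  obtain ⟨q, hq⟩ : ∃ q, D 2 0 = q * s₂ := ⟨D 2 0 / s₂, by field_simp⟩
  obtain ⟨p, hp⟩ : ∃ p, D 2 1 = -(p * s₂) := ⟨-(D 2 1 / s₂), by field_simp⟩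
  rcases lt_trichotomy (D 0 0 ^ 2 + D 0 1 * D 1 0) 0 with hd | hd | hd
  · set δ := √(-(D 0 0 ^ 2 + D 0 1 * D 1 0)) with hδ
    have hδ0 : 0 < δ := Real.sqrt_pos.2 (by linarith)
    have hsq : δ ^ 2 = -(D 0 0 ^ 2 + D 0 1 * D 1 0) := Real.sq_sqrt (by linarith)
    have h10 : D 1 0 ≠ 0 := by
      intro h10
      rw [h10] at hd
      nlinarith [sq_nonneg (D 0 0)]
    -- The block is `δ` times a complex structure, under which `f 1` is the image of `b 0`; the
    -- center is paired with the corrected `b 3`.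
    obtain ⟨f, f0, f1, f2, f3⟩ := exists_basis_of_linearIndependent_four b (b 0)
      (δ⁻¹ • (D 0 0 • b 0 + D 1 0 • b 1)) (b 2) (b 3 + p • b 0 + q • b 1)
      (fun c₀ c₁ c₂ c₃ hc => by
        obtain ⟨k0, k1, k2, k3⟩ := coeffs_eq_zero b (c₀ := c₀ + c₁ * δ⁻¹ * D 0 0 + c₃ * p)
          (c₁ := c₁ * δ⁻¹ * D 1 0 + c₃ * q) (c₂ := c₂) (c₃ := c₃) (by rw [← hc]; module)
        subst k3
        have k1' : c₁ = 0 := by simpa [h10, hδ0.ne'] using k1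
        subst k1'
        simpa using And.intro k0 k2)
    have h01 : D 0 1 = -(D 0 0 ^ 2 + δ ^ 2) / D 1 0 := by
      rw [hsq]
      field_simp
      ring
    refine exists_isGeneralizedComplexStructure_of_complex_frame f (-δ) 0 0 0 ?_ ?_ <;>
      simp only [f0, f1, f2, f3, lie_add, add_lie, lie_smul, smul_lie, lie_self, h.lie12, h.lie02,
        h.lie01, h.lie03, h.lie13, ← lie_skew (b 1) (b 0), d11, hq, hp, h01] <;>
      match_scalars <;> field_simp <;> ring
  -- The block is nilpotent, and θ is a nonzero covector that it kills. The symplectic form is `θ ∧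
  -- e² + (θ₁ e⁰ - θ₀ e¹) ∧ e³` for the basis with the corrected `b 3`, with Pfaffian `θ₀² + θ₁²`.
  · obtain ⟨θ₀, θ₁, hθ, t0, t1⟩ : ∃ θ₀ θ₁ : ℝ, θ₀ ^ 2 + θ₁ ^ 2 ≠ 0 ∧
        θ₀ * D 0 0 + θ₁ * D 1 0 = 0 ∧ θ₀ * D 0 1 - θ₁ * D 0 0 = 0 := by
      by_cases hz : D 1 0 ^ 2 + D 0 0 ^ 2 = 0
      · have h1 : D 1 0 = 0 := by nlinarith [sq_nonneg (D 1 0), sq_nonneg (D 0 0)]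
        have h2 : D 0 0 = 0 := by nlinarith [sq_nonneg (D 1 0), sq_nonneg (D 0 0)]
        exact ⟨0, 1, by norm_num, by rw [h1]; ring, by rw [h2]; ring⟩
      · exact ⟨-D 1 0, D 0 0, by rwa [neg_sq], by ring, by linear_combination -hd⟩
    refine exists_isGeneralizedComplexStructure_of_symplectic_frame b 0 θ₀ θ₁ θ₁
      (-θ₀) (q * θ₁ + p * θ₀) (fun h => hθ (by linear_combination h)) ?_
    intro ω alt e01 e02 e03 e12 e13 e23 e10 e20 e30 e21 e31 e32
    simp only [h.lie01, h.lie02, h.lie12, h.lie03, h.lie13, h.lie23, map_add, map_smul,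
      LinearMap.add_apply, LinearMap.smul_apply, smul_eq_mul, alt,
      e01, e02, e03, e12, e13, e23, e10, e20, e21, d02, d12, d11, ht, hq, hp]
    refine ⟨?_, ?_, ?_, ?_⟩
    · ring
    · ring
    · linear_combination t0
    · linear_combination t1
  · set l := √(D 0 0 ^ 2 + D 0 1 * D 1 0) with hl
    have hl0 : 0 < l := Real.sqrt_pos.2 hd
    have hsq : l ^ 2 = D 0 0 ^ 2 + D 0 1 * D 1 0 := Real.sq_sqrt hd.le
    obtain ⟨x, y, x', y', e1, e2, e3, e4, hdet⟩ :=
      exists_eigenvectors_of_trace_eq_zero hl0.ne' hsq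
    set κ := x * y' - y * x' with hκ
    -- The complex structure pairs the eigenvector for `l` with `m • b 2`, and the corrected `b 3`
    -- with the eigenvector for `-l`. The integrability condition is that the two eigenvectors have
    -- bracket `-l m • b 2`.
    obtain ⟨m, hm⟩ : ∃ m, κ * s₂ = -(l * m) := ⟨-(κ * s₂ / l), by field_simp⟩
    have hm0 : m ≠ 0 := by
      rintro rfl
      simp [hdet, h2] at hm
    obtain ⟨f, f0, f1, f2, f3⟩ := exists_basis_of_linearIndependent_four b (x • b 0 + y • b 1)
      (m • b 2) (b 3 + p • b 0 + q • b 1) (x' • b 0 + y' • b 1)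
      (fun c₀ c₁ c₂ c₃ hc => by
        obtain ⟨k0, k1, k2, k3⟩ := coeffs_eq_zero b (c₀ := c₀ * x + c₂ * p + c₃ * x')
          (c₁ := c₀ * y + c₂ * q + c₃ * y') (c₂ := c₁ * m) (c₃ := c₂) (by rw [← hc]; module)
        subst k3
        refine ⟨(mul_eq_zero.1 ?_).resolve_right hdet, (mul_eq_zero.1 k2).resolve_right hm0, rfl,
          (mul_eq_zero.1 ?_).resolve_right hdet⟩
        · linear_combination y' * k0 - x' * k1
        · linear_combination x * k1 - y * k0)
    refine exists_isGeneralizedComplexStructure_of_complex_frame f (-l) 0 0 0 ?_ ?_ <;>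
      simp only [f0, f1, f2, f3, lie_add, add_lie, lie_smul, smul_lie, lie_self, h.lie12, h.lie02,
        h.lie01, h.lie03, h.lie13, h.lie23, ← lie_skew (b 1) (b 0), ← lie_skew (b 2) (b 0),
        ← lie_skew (b 2) (b 1), d02, d12, d11, ht, hq, hp] <;>
      match_scalars
    · linear_combination -e1
    · linear_combination -e2
    · ring
    · ring
    · linear_combination hm
    · ring
    · ring
    · ring

/-- A four-dimensional algebra with a unimodular ideal of dimension three carries a generalized
complex structure or belongs to the list. -/
theorem IsMilnorBasis.hasGeneralizedComplexStructure_or_isListed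
    (h : IsMilnorBasis b s₀ s₁ s₂ D) : HasGeneralizedComplexStructure g ∨ IsListed g := by
  obtain ⟨b', h'⟩ := h.rotate
  obtain ⟨b'', h''⟩ := h'.rotate
  by_cases h0 : s₀ = 0 <;> by_cases h1 : s₁ = 0 <;> by_cases h2 : s₂ = 0
  · subst h0 h1 h2
    refine hasGeneralizedComplexStructure_or_isListed_of_abelian_ideal b (fun i j => -D i j)
      ?_ ?_ ?_ h.lie03 h.lie13 h.lie23
    · rw [h.lie01, zero_smul]
    · rw [h.lie02, neg_zero, zero_smul]
    · rw [h.lie12, zero_smul]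
  · subst h0 h1
    exact Or.inl (h.hasGeneralizedComplexStructure_of_rank_one h2)
  · subst h0 h2
    exact Or.inl (h''.hasGeneralizedComplexStructure_of_rank_one h1)
  · subst h0
    exact Or.inl (h'.hasGeneralizedComplexStructure_of_rank_two h1 h2)
  · subst h1 h2
    exact Or.inl (h'.hasGeneralizedComplexStructure_of_rank_one h0)
  · subst h1
    exact Or.inl (h''.hasGeneralizedComplexStructure_of_rank_two h2 h0)
  · subst h2
    exact Or.inl (h.hasGeneralizedComplexStructure_of_rank_two h0 h1)
  · exact Or.inl (h.hasGeneralizedComplexStructure_of_ne_zero h0 h1 h2)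

end UnimodularIdeal

/-! ### A closed one-form with unimodular kernel. -/

section ClosedForm

variable {g : Type*} [LieRing g] [LieAlgebra ℝ g]

theorem trace_ad_eq (b : Module.Basis (Fin 4) ℝ g) (x : g) :
    LinearMap.trace ℝ g (LieAlgebra.ad ℝ g x) = b.repr ⁅x, b 0⁆ 0 + b.repr ⁅x, b 1⁆ 1 +
      b.repr ⁅x, b 2⁆ 2 + b.repr ⁅x, b 3⁆ 3 := by
  rw [LinearMap.trace_eq_matrix_trace ℝ b, Matrix.trace, Fin.sum_univ_four]
  simp [LinearMap.toMatrix_apply]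

/-- On a unimodular algebra of dimension four, the differential of a one-form has square zero. -/
theorem pfaffian_eq_zero_of_trace_ad (b : Module.Basis (Fin 4) ℝ g)
    (hg : ∀ x : g, LinearMap.trace ℝ g (LieAlgebra.ad ℝ g x) = 0) (α : Module.Dual ℝ g) :
    α ⁅b 0, b 1⁆ * α ⁅b 2, b 3⁆ - α ⁅b 0, b 2⁆ * α ⁅b 1, b 3⁆ + α ⁅b 0, b 3⁆ * α ⁅b 1, b 2⁆ = 0 := by
  have t0 := hg (b 0)
  have t1 := hg (b 1)
  have t2 := hg (b 2)
  have t3 := hg (b 3)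
  rw [trace_ad_eq b] at t0 t1 t2 t3
  rw [← lie_skew (b 1) (b 0)] at t1
  rw [← lie_skew (b 2) (b 0), ← lie_skew (b 2) (b 1)] at t2
  rw [← lie_skew (b 3) (b 0), ← lie_skew (b 3) (b 1), ← lie_skew (b 3) (b 2)] at t3
  simp only [lie_self, map_zero, map_neg, Finsupp.zero_apply, Finsupp.neg_apply] at t0 t1 t2 t3
  have hα : ∀ u, α u = b.repr u 0 * α (b 0) + b.repr u 1 * α (b 1) + b.repr u 2 * α (b 2) +
      b.repr u 3 * α (b 3) := by
    intro u
    conv_lhs => rw [eq_sum_four b u]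
    simp only [map_add, map_smul, smul_eq_mul]
  have hl : ∀ u v, α ⁅u, v⁆ = b.repr u 0 * α ⁅b 0, v⁆ + b.repr u 1 * α ⁅b 1, v⁆ +
      b.repr u 2 * α ⁅b 2, v⁆ + b.repr u 3 * α ⁅b 3, v⁆ := by
    intro u v
    conv_lhs => rw [eq_sum_four b u]
    simp only [add_lie, smul_lie, map_add, map_smul, smul_eq_mul]
  have hjac : ∀ u v w : g, α ⁅⁅u, v⁆, w⁆ + α ⁅⁅v, w⁆, u⁆ - α ⁅⁅u, w⁆, v⁆ = 0 := by
    intro u v w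
    have h := congrArg α (lie_jacobi u v w)
    rw [← lie_skew w u] at h
    rw [← lie_skew ⁅u, v⁆ w, ← lie_skew ⁅v, w⁆ u, ← lie_skew ⁅u, w⁆ v]
    simp only [map_add, map_neg, map_zero, lie_neg] at h ⊢
    linarith
  have j012 := hjac (b 0) (b 1) (b 2)
  have j013 := hjac (b 0) (b 1) (b 3)
  have j023 := hjac (b 0) (b 2) (b 3)
  have j123 := hjac (b 1) (b 2) (b 3)
  rw [hl ⁅b 0, b 1⁆, hl ⁅b 1, b 2⁆, hl ⁅b 0, b 2⁆] at j012
  rw [hl ⁅b 0, b 1⁆, hl ⁅b 1, b 3⁆, hl ⁅b 0, b 3⁆] at j013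
  rw [hl ⁅b 0, b 2⁆, hl ⁅b 2, b 3⁆, hl ⁅b 0, b 3⁆] at j023
  rw [hl ⁅b 1, b 2⁆, hl ⁅b 2, b 3⁆, hl ⁅b 1, b 3⁆] at j123
  have a01 := hα ⁅b 0, b 1⁆
  have a02 := hα ⁅b 0, b 2⁆
  have a03 := hα ⁅b 0, b 3⁆
  have a12 := hα ⁅b 1, b 2⁆
  have a13 := hα ⁅b 1, b 3⁆
  have a23 := hα ⁅b 2, b 3⁆
  have s10 : α ⁅b 1, b 0⁆ = -α ⁅b 0, b 1⁆ := by rw [← lie_skew, map_neg]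
  have s20 : α ⁅b 2, b 0⁆ = -α ⁅b 0, b 2⁆ := by rw [← lie_skew, map_neg]
  have s30 : α ⁅b 3, b 0⁆ = -α ⁅b 0, b 3⁆ := by rw [← lie_skew, map_neg]
  have s21 : α ⁅b 2, b 1⁆ = -α ⁅b 1, b 2⁆ := by rw [← lie_skew, map_neg]
  have s31 : α ⁅b 3, b 1⁆ = -α ⁅b 1, b 3⁆ := by rw [← lie_skew, map_neg]
  have s32 : α ⁅b 3, b 2⁆ = -α ⁅b 2, b 3⁆ := by rw [← lie_skew, map_neg]
  simp only [lie_self, map_zero, s10, s20, s30, s21, s31, s32] at j012 j013 j023 j123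
  generalize α ⁅b 0, b 1⁆ = A01, α ⁅b 0, b 2⁆ = A02, α ⁅b 0, b 3⁆ = A03, α ⁅b 1, b 2⁆ = A12,
    α ⁅b 1, b 3⁆ = A13, α ⁅b 2, b 3⁆ = A23, α (b 0) = a0, α (b 1) = a1, α (b 2) = a2,
    α (b 3) = a3 at *
  -- In coordinates, `dα ∧ dα = d(α ∧ dα)`, and `d` vanishes on three-forms of a unimodular algebra.
  -- The `j` terms come from `d²α = 0`, the `t` terms from the traces.
  linear_combination (1 / 2) * (A23 * a01 - A13 * a02 + A12 * a03 + A03 * a12 - A02 * a13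
    + A01 * a23 + a0 * j123 - a1 * j023 + a2 * j013 - a3 * j012
    + (a1 * A23 - a2 * A13 + a3 * A12) * t0 - (a0 * A23 - a2 * A03 + a3 * A02) * t1
    + (a0 * A13 - a1 * A03 + a3 * A01) * t2 - (a0 * A12 - a1 * A02 + a2 * A01) * t3)

/-- A four-dimensional algebra is not perfect if it is unimodular. -/
theorem exists_closed_of_trace_ad (b : Module.Basis (Fin 4) ℝ g)
    (hg : ∀ x : g, LinearMap.trace ℝ g (LieAlgebra.ad ℝ g x) = 0) :
    ∃ φ : Module.Dual ℝ g, φ ≠ 0 ∧ ∀ x y : g, φ ⁅x, y⁆ = 0 := by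
  have : FiniteDimensional ℝ g := b.finiteDimensional_of_finite
  by_contra! hcon
  -- Two-forms in dimension four are `ℝ³ × ℝ³`, and the wedge product pairs the factors. By
  -- polarization of the Pfaffian identity the image of `d = (d₁, d₂)` is isotropic, so it has
  -- dimension at most three and `d` cannot be injective on the four-dimensional dual.
  let d₁ : Module.Dual ℝ g →ₗ[ℝ] (Fin 3 → ℝ) :=
    LinearMap.pi ![LinearMap.applyₗ ⁅b 0, b 1⁆, LinearMap.applyₗ ⁅b 0, b 2⁆,
      LinearMap.applyₗ ⁅b 0, b 3⁆]
  let d₂ : Module.Dual ℝ g →ₗ[ℝ] (Fin 3 → ℝ) :=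
    LinearMap.pi ![LinearMap.applyₗ ⁅b 2, b 3⁆, -LinearMap.applyₗ ⁅b 1, b 3⁆,
      LinearMap.applyₗ ⁅b 1, b 2⁆]
  have hd₁ : ∀ α, d₁ α = ![α ⁅b 0, b 1⁆, α ⁅b 0, b 2⁆, α ⁅b 0, b 3⁆] := by
    intro α
    ext i
    fin_cases i <;> rfl
  have hd₂ : ∀ α, d₂ α = ![α ⁅b 2, b 3⁆, -α ⁅b 1, b 3⁆, α ⁅b 1, b 2⁆] := by
    intro α
    ext i
    fin_cases i <;> rfl
  have hiso : ∀ α β, d₁ α ⬝ᵥ d₂ β + d₂ α ⬝ᵥ d₁ β = 0 := by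
    intro α β
    have h1 := pfaffian_eq_zero_of_trace_ad b hg α
    have h2 := pfaffian_eq_zero_of_trace_ad b hg β
    have h3 := pfaffian_eq_zero_of_trace_ad b hg (α + β)
    simp only [LinearMap.add_apply] at h3
    simp only [hd₁, hd₂, dotProduct, Fin.sum_univ_three, Matrix.cons_val]
    linear_combination h3 - h1 - h2
  have hinj : ∀ α, d₁ α = 0 → d₂ α = 0 → α = 0 := by
    intro α h1 h2
    by_contra hα
    obtain ⟨x, y, hxy⟩ := hcon α hα
    apply hxy
    rw [hd₁] at h1
    rw [hd₂] at h2
    have k0 := congrFun h1 0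
    have k1 := congrFun h1 1
    have k2 := congrFun h1 2
    have k3 := congrFun h2 0
    have k4 := congrFun h2 1
    have k5 := congrFun h2 2
    simp at k0 k1 k2 k3 k4 k5
    rw [lie_eq_sum_four b]
    simp [k0, k1, k2, k3, k4, k5]
  -- Isotropy makes `d₂ (ker d₁)` orthogonal to the range of `d₁` in `ℝ³`. If `d` were injective,
  -- these subspaces would have dimensions of sum four.
  have hdisj : Disjoint (LinearMap.range d₁) ((LinearMap.ker d₁).map d₂) := by
    rw [Submodule.disjoint_def]
    rintro _ ⟨β, rfl⟩ ⟨α, hα, hαβ⟩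
    have h := hiso α β
    rw [LinearMap.mem_ker.1 hα, zero_dotProduct, zero_add, hαβ] at h
    exact dotProduct_self_eq_zero.1 h
  have h1 := Submodule.finrank_add_finrank_le_of_disjoint hdisj
  have h2 := LinearMap.finrank_range_add_finrank_ker d₁
  have h3 : Module.finrank ℝ ((LinearMap.ker d₁).map d₂) = Module.finrank ℝ (LinearMap.ker d₁) := by
    have hker : Function.Injective (d₂.domRestrict (LinearMap.ker d₁)) := by
      rw [injective_iff_map_eq_zero]
      rintro ⟨α, hα⟩ h
      exact Subtype.ext (hinj α hα h)
    rw [← LinearMap.range_domRestrict]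
    exact LinearMap.finrank_range_of_inj hker
  rw [Subspace.dual_finrank_eq, Module.finrank_eq_card_basis b] at h2
  simp at h1 h2
  omega

/-- A four-dimensional algebra has a closed one-form whose kernel is a unimodular ideal. -/
theorem exists_closed (b : Module.Basis (Fin 4) ℝ g) :
    ∃ φ : Module.Dual ℝ g, φ ≠ 0 ∧ (∀ x y : g, φ ⁅x, y⁆ = 0) ∧
      ∀ x, φ x = 0 → LinearMap.trace ℝ g (LieAlgebra.ad ℝ g x) = 0 := by
  let τ : Module.Dual ℝ g := LinearMap.trace ℝ g ∘ₗ (LieAlgebra.ad ℝ g : g →ₗ[ℝ] Module.End ℝ g)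
  have hτ : ∀ x, τ x = LinearMap.trace ℝ g (LieAlgebra.ad ℝ g x) := fun _ => rfl
  -- The trace form is closed since commutators have trace zero, and it vanishes on its own kernel;
  -- so it serves unless `g` is unimodular.
  by_cases h : τ = 0
  · have hg : ∀ x : g, LinearMap.trace ℝ g (LieAlgebra.ad ℝ g x) = 0 := fun x => by
      rw [← hτ, h]
      rfl
    obtain ⟨φ, h1, h2⟩ := exists_closed_of_trace_ad b hg
    exact ⟨φ, h1, h2, fun x _ => hg x⟩
  · refine ⟨τ, h, fun x y => ?_, fun x hx => hx⟩
    have h : LieAlgebra.ad ℝ g ⁅x, y⁆ =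
        LieAlgebra.ad ℝ g x * LieAlgebra.ad ℝ g y - LieAlgebra.ad ℝ g y * LieAlgebra.ad ℝ g x := by
      ext z
      exact lie_lie x y z
    rw [hτ, h, map_sub, LinearMap.trace_mul_comm, sub_self]

end ClosedForm

/-! ### Diagonalizing the bracket of the unimodular ideal. -/

section MilnorBasis

/-- A symmetric endomorphism of `ℝ³` is diagonalized by a basis compatible with the cross product. -/
theorem exists_cross_eigenbasis (S : Matrix (Fin 3) (Fin 3) ℝ) (hS : S.IsSymm) :
    ∃ (u v w : Fin 3 → ℝ) (s₀ s₁ s₂ : ℝ), (∀ c₀ c₁ c₂ : ℝ, c₀ • u + c₁ • v + c₂ • w = 0 →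
      c₀ = 0 ∧ c₁ = 0 ∧ c₂ = 0) ∧ S *ᵥ (crossProduct v w) = s₀ • u ∧
      S *ᵥ (crossProduct w u) = s₁ • v ∧ S *ᵥ (crossProduct u v) = s₂ • w := by
  have hH : S.IsHermitian := by
    rw [Matrix.IsHermitian, Matrix.conjTranspose_eq_transpose_of_trivial]
    exact hS
  set E := hH.eigenvectorBasis with hE
  let e : Fin 3 → Fin 3 → ℝ := fun i => ⇑(E i)
  have heig : ∀ i, S *ᵥ e i = hH.eigenvalues i • e i := hH.mulVec_eigenvectorBasis
  have hexp : ∀ x : Fin 3 → ℝ, x = (e 0 ⬝ᵥ x) • e 0 + (e 1 ⬝ᵥ x) • e 1 + (e 2 ⬝ᵥ x) • e 2 := by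
    intro x
    have h := congrArg WithLp.ofLp (E.sum_repr' (WithLp.toLp 2 x))
    simp only [Fin.sum_univ_three, WithLp.ofLp_add, WithLp.ofLp_smul,
      EuclideanSpace.inner_eq_star_dotProduct, star_trivial] at h
    rw [dotProduct_comm (e 0), dotProduct_comm (e 1), dotProduct_comm (e 2)]
    exact h.symm
  have hli : LinearIndependent ℝ e := by
    exact E.orthonormal.linearIndependent.map' (WithLp.linearEquiv 2 ℝ (Fin 3 → ℝ)).toLinearMap
      (LinearEquiv.ker _)
  -- In an orthonormal eigenbasis each cross product of two vectors is a multiple of the third. The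
  -- triple products absorb the orientation of the basis, which is not known.
  refine ⟨e 0, e 1, e 2, (e 0 ⬝ᵥ crossProduct (e 1) (e 2)) * hH.eigenvalues 0,
    (e 1 ⬝ᵥ crossProduct (e 2) (e 0)) * hH.eigenvalues 1,
    (e 2 ⬝ᵥ crossProduct (e 0) (e 1)) * hH.eigenvalues 2, ?_, ?_, ?_, ?_⟩
  · intro c₀ c₁ c₂ hc
    rw [Fintype.linearIndependent_iff] at hli
    have h := hli ![c₀, c₁, c₂] (by rw [Fin.sum_univ_three]; exact hc)
    exact ⟨h 0, h 1, h 2⟩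
  · conv_lhs => rw [hexp (crossProduct (e 1) (e 2)), dot_self_cross, dot_cross_self]
    simp only [zero_smul, add_zero, Matrix.mulVec_smul, heig, smul_smul]
  · conv_lhs => rw [hexp (crossProduct (e 2) (e 0)), dot_self_cross, dot_cross_self]
    simp only [zero_smul, add_zero, zero_add, Matrix.mulVec_smul, heig, smul_smul]
  · conv_lhs => rw [hexp (crossProduct (e 0) (e 1)), dot_self_cross, dot_cross_self]
    simp only [zero_smul, zero_add, Matrix.mulVec_smul, heig, smul_smul]

variable {g : Type*} [LieRing g] [LieAlgebra ℝ g]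

theorem exists_basis_isLastCoord (b : Module.Basis (Fin 4) ℝ g) {φ : Module.Dual ℝ g} (hφ : φ ≠ 0) :
    ∃ e : Module.Basis (Fin 4) ℝ g, IsLastCoord φ e := by
  have : FiniteDimensional ℝ g := b.finiteDimensional_of_finite
  have hker : Module.finrank ℝ (LinearMap.ker φ) = 3 := by
    have h := Module.Dual.finrank_ker_add_one_of_ne_zero hφ
    rw [Module.finrank_eq_card_basis b] at h
    simpa using h
  let k := Module.finBasisOfFinrankEq ℝ _ hker
  obtain ⟨t, ht⟩ : ∃ t, φ t = 1 := by
    obtain ⟨x, hx⟩ : ∃ x, φ x ≠ 0 := by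
      by_contra! h
      exact hφ (LinearMap.ext h)
    exact ⟨(φ x)⁻¹ • x, by simp [hx]⟩
  have hk : ∀ i, φ (k i : g) = 0 := fun i => (k i).2
  obtain ⟨e, e0, e1, e2, e3⟩ := exists_basis_of_linearIndependent_four b (k 0 : g) (k 1) (k 2) t
    (fun c₀ c₁ c₂ c₃ hc => by
      have h3 := congrArg φ hc
      simp [hk, ht] at h3
      subst h3
      have h := Fintype.linearIndependent_iff.1 k.linearIndependent ![c₀, c₁, c₂] (by
        apply Subtype.ext
        rw [Fin.sum_univ_three]
        simpa using hc)
      exact ⟨h 0, h 1, h 2, rfl⟩)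
  exact ⟨e, by rw [e0, hk], by rw [e1, hk], by rw [e2, hk], by rw [e3, ht]⟩

/-- A bracket on a three-dimensional space is `S (x × y)` for a unique matrix `S`, and unimodularity
amounts to the symmetry of `S` (Milnor). An eigenbasis of `S` then makes the bracket diagonal. -/
theorem exists_isMilnorBasis (b : Module.Basis (Fin 4) ℝ g) :
    ∃ (f : Module.Basis (Fin 4) ℝ g) (s₀ s₁ s₂ : ℝ) (D : Fin 3 → Fin 3 → ℝ),
      IsMilnorBasis f s₀ s₁ s₂ D := by
  obtain ⟨φ, hφ, hclosed, htr⟩ := exists_closed b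
  obtain ⟨e, he⟩ := exists_basis_isLastCoord b hφ
  have h3 : ∀ x y : g, e.repr ⁅x, y⁆ 3 = 0 := fun x y => by rw [← he.apply, hclosed]
  let S : Matrix (Fin 3) (Fin 3) ℝ :=
    !![e.repr ⁅e 1, e 2⁆ 0, e.repr ⁅e 2, e 0⁆ 0, e.repr ⁅e 0, e 1⁆ 0;
      e.repr ⁅e 1, e 2⁆ 1, e.repr ⁅e 2, e 0⁆ 1, e.repr ⁅e 0, e 1⁆ 1;
      e.repr ⁅e 1, e 2⁆ 2, e.repr ⁅e 2, e 0⁆ 2, e.repr ⁅e 0, e 1⁆ 2]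
  -- Brackets have no component on `e 3`, so the trace of `ad (e i)` on `g` is its trace on the
  -- ideal. Its vanishing for `i = 0, 1, 2` equates the off-diagonal entries of `S` in pairs.
  have hS : S.IsSymm := by
    have t0 := htr _ he.apply0
    have t1 := htr _ he.apply1
    have t2 := htr _ he.apply2
    rw [trace_ad_eq e, h3, lie_self] at t0 t1 t2
    rw [← lie_skew (e 0) (e 2)] at t0
    rw [← lie_skew (e 1) (e 0)] at t1
    rw [← lie_skew (e 2) (e 1)] at t2
    simp only [map_zero, map_neg, Finsupp.zero_apply, Finsupp.neg_apply] at t0 t1 t2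
    ext i j
    fin_cases i <;> fin_cases j <;> simp [S] <;> linarith
  obtain ⟨u, v, w, s₀, s₁, s₂, hli, hu, hv, hw⟩ := exists_cross_eigenbasis S hS
  let ι : (Fin 3 → ℝ) →ₗ[ℝ] g :=
    { toFun := fun v => v 0 • e 0 + v 1 • e 1 + v 2 • e 2
      map_add' := fun v w => by
        simp only [Pi.add_apply]
        module
      map_smul' := fun c v => by
        simp only [Pi.smul_apply, smul_eq_mul, RingHom.id_apply]
        module }
  have hι : ∀ v, ι v = v 0 • e 0 + v 1 • e 1 + v 2 • e 2 := fun _ => rfl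
  have hφι : ∀ v, φ (ι v) = 0 := fun v => by
    rw [hι]
    simp [he.apply0, he.apply1, he.apply2]
  have hlie : ∀ x y, ⁅ι x, ι y⁆ = ι (S *ᵥ crossProduct x y) := by
    intro x y
    have h12 := eq_sum_four e ⁅e 1, e 2⁆
    have h20 := eq_sum_four e ⁅e 2, e 0⁆
    have h01 := eq_sum_four e ⁅e 0, e 1⁆
    rw [h3, zero_smul, add_zero] at h12 h20 h01
    simp only [hι, add_lie, lie_add, smul_lie, lie_smul, lie_self, ← lie_skew (e 1) (e 0),
      ← lie_skew (e 2) (e 1), ← lie_skew (e 0) (e 2)]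
    rw [h12, h20, h01]
    simp only [cross_apply, Matrix.mulVec, dotProduct, Fin.sum_univ_three, S, Matrix.of_apply,
      Matrix.cons_val]
    module
  obtain ⟨f, f0, f1, f2, f3⟩ := exists_basis_of_embedding (e := e) hι hli
  have hf : IsLastCoord φ f :=
    ⟨by rw [f0, hφι], by rw [f1, hφι], by rw [f2, hφι], by rw [f3, he.apply3]⟩
  have h3' : ∀ x y : g, f.repr ⁅x, y⁆ 3 = 0 := fun x y => by rw [← hf.apply, hclosed]
  refine ⟨f, s₀, s₁, s₂, fun i j => -f.repr ⁅f (Fin.castSucc j), f 3⁆ (Fin.castSucc i),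
    ?_, ?_, ?_, ?_, ?_, ?_⟩
  · rw [f0, f1, f2, hlie, hu, map_smul]
  · rw [f0, f1, f2, ← lie_skew, hlie, hv, map_smul, neg_smul]
  · rw [f0, f1, f2, hlie, hw, map_smul]
  · conv_lhs => rw [eq_sum_four f ⁅f 0, f 3⁆, h3', zero_smul, add_zero]
    simp only [neg_neg]
    rfl
  · conv_lhs => rw [eq_sum_four f ⁅f 1, f 3⁆, h3', zero_smul, add_zero]
    simp only [neg_neg]
    rfl
  · conv_lhs => rw [eq_sum_four f ⁅f 2, f 3⁆, h3', zero_smul, add_zero]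
    simp only [neg_neg]
    rfl

end MilnorBasis

theorem corollary3p1 {g : Type*} [LieRing g] [LieAlgebra ℝ g] (hdim : Module.finrank ℝ g = 4) :
    (¬ ∃ K : Module.End ℝ (g × Module.Dual ℝ g), IsGeneralizedComplexStructure K) ↔
      (Nonempty (g ≃ₗ⁅ℝ⁆ (LieA32 × LieA1)) ∨
        (∃ α : ℝ, 0 < |α| ∧ |α| < 1 ∧ Nonempty (g ≃ₗ⁅ℝ⁆ (LieA35 α × LieA1))) ∨
        Nonempty (g ≃ₗ⁅ℝ⁆ LieA44) ∨
        (∃ α : ℝ, |α| ≠ 1 ∧ Nonempty (g ≃ₗ⁅ℝ⁆ LieA42 α)) ∨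
        (∃ α β : ℝ, -1 < α ∧ α < β ∧ β < 1 ∧ α + β ≠ 0 ∧ Nonempty (g ≃ₗ⁅ℝ⁆ LieA45 α β))) := by
  constructor
  · intro h
    have : FiniteDimensional ℝ g := Module.finite_of_finrank_pos (by rw [hdim]; norm_num)
    obtain ⟨f, s₀, s₁, s₂, D, hf⟩ := exists_isMilnorBasis (Module.finBasisOfFinrankEq ℝ g hdim)
    exact hf.hasGeneralizedComplexStructure_or_isListed.resolve_left h
  · exact IsListed.not_exists_isGeneralizedComplexStructure
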